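/- Let $p\in(0,1]$, $q\in[0,1)$ with $p^2+q^2=1$, let $\alpha,\beta,\gamma\in\mathbf R$, and put $$C_0=e^{i\gamma/2}\begin{bmatrix} p e^{i(\alpha-\gamma/2)} & q e^{i(\beta-\gamma/2)}\\ -q e^{-i(\beta-\gamma/2)} & p e^{-i(\alpha-\gamma/2)}\end{bmatrix}.$$ For each $x\in\mathbf Z$ let $C(x)=\begin{bmatrix} a(x)&b(x)\\ c(x)&d(x)\end{bmatrix}\in U(2)$, and assume that there are constants $\epsilon_0,M,\delta>0$ such that every entry of $C(x)-C_0$ is bounded in absolute value by $Me^{-\epsilon_0\sqrt{1+x^2}}$, and $|a(x)|\ge\delta$, for all $x\in\mathbf Z$. For $u:\mathbf Z\to\mathbf C^2$ let $$(Uu)(x)=\begin{bmatrix} a(x+1)&b(x+1)\\0&0\end{bmatrix}u(x+1)+\begin{bmatrix}0&0\\ c(x-1)&d(x-1)\end{bmatrix}u(x-1).$$ Let $\mathcal B^*(\mathbf Z)$ be the space of $u:\mathbf Z\to\mathbf C^2$ with $\sup_{R>1}\frac1R\sum_{|x|<R}|u(x)|^2<\infty$. Let $J_\gamma=[\arccos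 p+\frac\gamma2,\pi-\arccos p+\frac\gamma2]\cup[\pi+\arccos p+\frac\gamma2,2\pi-\arccos p+\frac\gamma2]$, and let $J_{\gamma,\mathcal T}$ be the set of the four endpoints; thus $\{e^{i\theta}:\theta\in J_\gamma\}$ is the essential spectrum of $U$ on $\ell^2(\mathbf Z;\mathbf C^2)$ and $\{e^{i\theta}:\theta\in J_{\gamma,\mathcal T}\}$ is the set of thresholds. Put $\widehat U_0(\xi)=\mathrm{diag}(e^{i\xi},e^{-i\xi})C_0$, $\theta(\xi)=\frac\gamma2+\arccos(p\cos(\xi+\alpha-\frac\gamma2))$, and $M(\theta)=\{\xi\in\mathbf R/2\pi\mathbf Z:\det(\widehat U_0(\xi)-e^{i\theta})=0\}$. Let $P_1(\xi)$, $P_2(\xi)$ be the orthogonal projections onto the eigenspaces of $\widehat U_0(\xi)$ for the eigenvalues $\lambda_1(\xi)=e^{i\theta(\xi)}$, $\lambda_2(\xi)=e^{i(\gamma-\theta(\xi))}$. For $u\in\mathcal B^*(\mathbf Z)$ let $\widehat u=(2\pi)^{-1/2}\sum_{x}e^{-ix\xi}u(x)$, a distribution on the torus. For a point $\xi_0$,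 a direction $\sigma\in\{\pm1\}$ and a smooth coordinate $\eta$ near $\xi_0$, we say that $(\xi_0,\sigma)\notin WF^*(P_j\widehat u)$ if there is a smooth function $\psi$, supported in a small neighbourhood of $\xi_0$ on which $P_j$ is smooth, with $\psi(\xi_0)=1$ and $$\lim_{R\to\infty}\frac1R\int_{|s|<R,\ \mathrm{sgn}\,s=\sigma}\bigl|\widetilde{\psi P_j\widehat u}(s)\bigr|^2ds=0,$$ where $\widetilde v(s)=(2\pi)^{-1/2}\int e^{-is\eta}v(\eta)\,d\eta$ is the Fourier transform of $v$ written in the coordinate $\eta$. The radiation condition of sign $\pm$, with respect to the coordinate $\eta$, is: for every $\xi_0\in M(\theta)$, $$(\xi_0,\pm1)\notin WF^*(P_1\widehat u),\qquad (\xi_0,\mp1)\notin WF^*(P_2\widehat u);$$ that is, over $M(\theta)$ the set $WF^*(P_1\widehat u)$ contains only the direction $\mp1$ and $WF^*(P_2\widehat u)$ only the direction $\pm1$. **Theorem.** Let $\theta\in J_\gamma\setminus J_{\gamma,\mathcal T}$, and let $u_\pm\in\mathcal B^*(\mathbf Z)$ satisfy $(U-e^{i\theta})u_\pm=0$ and the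 radiation condition of sign $\pm$, respectively, with respect to either the coordinate $\eta=\theta(\xi)$ or the coordinate $\eta=\xi$. Then $u_\pm=0$. -/

import Mathlib

open Filter Topology
open scoped ContDiff

noncomputable section

namespace QWalk

/-! ### The quantum walk -/

/-- Sequences on the lattice with values in `ℂ²`. -/
abbrev LatticeFun := ℤ → Fin 2 → ℂ

/-- The square of the Euclidean norm of `ℂ²`. -/
def normSq2 (v : Fin 2 → ℂ) : ℝ := ‖v 0‖ ^ 2 + ‖v 1‖ ^ 2

/-- The upper half `C₁ = [[a, b], [0, 0]]` of a coin matrix. -/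
def coinUpper (A : Matrix (Fin 2) (Fin 2) ℂ) : Matrix (Fin 2) (Fin 2) ℂ :=
  !![A 0 0, A 0 1; 0, 0]

/-- The lower half `C₂ = [[0, 0], [c, d]]` of a coin matrix. -/
def coinLower (A : Matrix (Fin 2) (Fin 2) ℂ) : Matrix (Fin 2) (Fin 2) ℂ :=
  !![0, 0; A 1 0, A 1 1]

/-- The time evolution `(U ψ)(x) = C₁(x+1) ψ(x+1) + C₂(x-1) ψ(x-1)`, on all sequences. -/
def evolution (C : ℤ → Matrix (Fin 2) (Fin 2) ℂ) (ψ : LatticeFun) : LatticeFun := fun x =>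
  (coinUpper (C (x + 1))).mulVec (ψ (x + 1)) + (coinLower (C (x - 1))).mulVec (ψ (x - 1))

/-- Parameters of the limiting (position-independent) coin. -/
structure LimitCoin where
  p : ℝ
  q : ℝ
  α : ℝ
  β : ℝ
  γ : ℝ
  p_pos : 0 < p
  p_le_one : p ≤ 1
  q_nonneg : 0 ≤ q
  q_lt_one : q < 1
  sq_add_sq : p ^ 2 + q ^ 2 = 1

variable (c : LimitCoin)

/-- The limiting coin
`C₀ = e^{iγ/2} [[p e^{i(α-γ/2)}, q e^{i(β-γ/2)}], [-q e^{-i(β-γ/2)}, p e^{-i(α-γ/2)}]]`. -/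
def LimitCoin.matrix : Matrix (Fin 2) (Fin 2) ℂ :=
  Complex.exp (Complex.I * ((c.γ / 2 : ℝ) : ℂ)) •
    !![(c.p : ℂ) * Complex.exp (Complex.I * ((c.α - c.γ / 2 : ℝ) : ℂ)),
       (c.q : ℂ) * Complex.exp (Complex.I * ((c.β - c.γ / 2 : ℝ) : ℂ));
       -(c.q : ℂ) * Complex.exp (-Complex.I * ((c.β - c.γ / 2 : ℝ) : ℂ)),
       (c.p : ℂ) * Complex.exp (-Complex.I * ((c.α - c.γ / 2 : ℝ) : ℂ))]

/-- The coins `C(x)` approach `C₀` exponentially fast, entry by entry. -/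
def ExpClose (C : ℤ → Matrix (Fin 2) (Fin 2) ℂ) : Prop :=
  ∃ ε M : ℝ, 0 < ε ∧ 0 < M ∧ ∀ (x : ℤ) (j k : Fin 2),
    ‖C x j k - c.matrix j k‖ ≤ M * Real.exp (-ε * Real.sqrt (1 + (x : ℝ) ^ 2))

/-- The entries `a(x)` are bounded away from zero. -/
def UpperLeftBounded (C : ℤ → Matrix (Fin 2) (Fin 2) ℂ) : Prop :=
  ∃ δ : ℝ, 0 < δ ∧ ∀ x : ℤ, δ ≤ ‖C x 0 0‖

/-- Membership in the Agmon–Hörmander space `𝓑*(ℤ)`: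
`sup_{R > 1} R⁻¹ ∑_{|x| < R} |u(x)|² < ∞`. -/
def MemBStar (u : LatticeFun) : Prop :=
  ∃ K : ℝ, ∀ R : ℝ, 1 < R →
    R⁻¹ * ∑ x ∈ Finset.Ioo (-⌈R⌉) ⌈R⌉, normSq2 (u x) ≤ K

/-! ### Symbol, bands, thresholds -/

/-- The intervals `J_{γ,1} ∪ J_{γ,2}`, parametrizing the essential spectrum. -/
def LimitCoin.J : Set ℝ :=
  Set.Icc (Real.arccos c.p + c.γ / 2) (Real.pi - Real.arccos c.p + c.γ / 2) ∪
  Set.Icc (Real.pi + Real.arccos c.p + c.γ / 2) (2 * Real.pi - Real.arccos c.p + c.γ / 2)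

/-- The thresholds, i.e. the endpoints of the two intervals. -/
def LimitCoin.thresholds : Set ℝ :=
  {Real.arccos c.p + c.γ / 2, Real.pi - Real.arccos c.p + c.γ / 2,
   Real.pi + Real.arccos c.p + c.γ / 2, 2 * Real.pi - Real.arccos c.p + c.γ / 2}

/-- The symbol `Û₀(ξ) = diag(e^{iξ}, e^{-iξ}) C₀` of the position-independent walk.
Functions on the torus are regarded as `2π`-periodic functions on `ℝ`. -/
def LimitCoin.symbol (ξ : ℝ) : Matrix (Fin 2) (Fin 2) ℂ :=
  Matrix.diagonal ![Complex.exp (Complex.I * (ξ : ℂ)), Complex.exp (-Complex.I * (ξ : ℂ))]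
    * c.matrix

/-- `M(θ) = {ξ : det (Û₀(ξ) - e^{iθ}) = 0}`. -/
def LimitCoin.fermi (θ : ℝ) : Set ℝ :=
  {ξ | (c.symbol ξ - Complex.exp (Complex.I * (θ : ℂ)) • (1 : Matrix (Fin 2) (Fin 2) ℂ)).det = 0}

/-- `θ(ξ) = γ/2 + arccos (p cos (ξ + α - γ/2))`. -/
def LimitCoin.phase (ξ : ℝ) : ℝ :=
  c.γ / 2 + Real.arccos (c.p * Real.cos (ξ + c.α - c.γ / 2))

/-- The eigenvalue `λ₁(ξ) = e^{iθ(ξ)}` of the symbol. -/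
def LimitCoin.eigval₁ (ξ : ℝ) : ℂ := Complex.exp (Complex.I * (c.phase ξ : ℂ))

/-- The eigenvalue `λ₂(ξ) = e^{i(γ-θ(ξ))}` of the symbol. -/
def LimitCoin.eigval₂ (ξ : ℝ) : ℂ := Complex.exp (Complex.I * ((c.γ - c.phase ξ : ℝ) : ℂ))

/-- The matrix of the orthogonal projection of `ℂ²` onto the eigenspace
`ker (A - μ)`. -/
def eigenProj (A : Matrix (Fin 2) (Fin 2) ℂ) (μ : ℂ) : Matrix (Fin 2) (Fin 2) ℂ :=
  Matrix.of fun k l =>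
    ((Module.End.eigenspace (Matrix.toEuclideanLin A) μ).starProjection
      (EuclideanSpace.single l (1 : ℂ))) k

/-- `P₁(ξ)`, the orthogonal projection onto the eigenspace of `λ₁(ξ)`. -/
def LimitCoin.proj₁ (ξ : ℝ) : Matrix (Fin 2) (Fin 2) ℂ := eigenProj (c.symbol ξ) (c.eigval₁ ξ)

/-- `P₂(ξ)`, the orthogonal projection onto the eigenspace of `λ₂(ξ)`. -/
def LimitCoin.proj₂ (ξ : ℝ) : Matrix (Fin 2) (Fin 2) ℂ := eigenProj (c.symbol ξ) (c.eigval₂ ξ)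

/-! ### Fourier series as distributions and the wave front set -/

/-- The Fourier series `û = (2π)^{-1/2} ∑_y e^{-iyξ} u(y)` of a polynomially bounded sequence,
as a (`2π`-periodic) distribution on `ℝ`, evaluated on a test function `g`. -/
def fourierPairing (u : ℤ → ℂ) (g : ℝ → ℂ) : ℂ :=
  (((Real.sqrt (2 * Real.pi))⁻¹ : ℝ) : ℂ) *
    ∑' y : ℤ, u y * ∫ ξ : ℝ, Complex.exp (-Complex.I * ((y * ξ : ℝ) : ℂ)) * g ξ

/-- Let `A` be a matrix-valued function and `ψ` a cut-off supported where `A` is smooth and the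
real function `φ` is a coordinate. This is the Fourier transform at `s`
of the compactly supported distribution `ψ A û`, written in the coordinate `η = φ(ξ)`:
`(2π)^{-1/2} ∫ e^{-isη} (ψ A û)(ξ(η)) dη = (2π)^{-1/2} ∫ e^{-isφ(ξ)} (ψ A û)(ξ) |φ'(ξ)| dξ`.
For `φ = id` it is the usual Fourier transform of `ψ A û`. -/
def localFourier (φ : ℝ → ℝ) (A : ℝ → Matrix (Fin 2) (Fin 2) ℂ) (u : LatticeFun)
    (ψ : ℝ → ℂ) (s : ℝ) : Fin 2 → ℂ := fun k =>
  (((Real.sqrt (2 * Real.pi))⁻¹ : ℝ) : ℂ) *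
    ∑ l : Fin 2, fourierPairing (fun y => u y l) fun ξ =>
      ψ ξ * A ξ k l * Complex.exp (-Complex.I * ((s * φ ξ : ℝ) : ℂ)) * ((|deriv φ ξ| : ℝ) : ℂ)

/-- `(ξ₀, σ)` is not in `WF*(A û)`: for some smooth `ψ` with small support and `ψ(ξ₀) = 1`, the
Fourier transform of `ψ A û` has vanishing mean square on the half-line `sgn s = σ`.
Small support means: contained in an open interval around `ξ₀`, of length at most the period, on
which `A` is smooth and `φ` is a coordinate. Covectors are measured in the coordinate `φ`. -/
def NotMemWF (φ : ℝ → ℝ) (A : ℝ → Matrix (Fin 2) (Fin 2) ℂ) (u : LatticeFun)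
    (ξ₀ : ℝ) (σ : ℤˣ) : Prop :=
  ∃ (r : ℝ) (ψ : ℝ → ℂ), 0 < r ∧ r ≤ Real.pi ∧
    (∀ k l, ContDiffOn ℝ ∞ (fun ξ => A ξ k l) (Set.Ioo (ξ₀ - r) (ξ₀ + r))) ∧
    ContDiffOn ℝ ∞ φ (Set.Ioo (ξ₀ - r) (ξ₀ + r)) ∧
    (∀ ξ ∈ Set.Ioo (ξ₀ - r) (ξ₀ + r), deriv φ ξ ≠ 0) ∧
    ContDiff ℝ ∞ ψ ∧ tsupport ψ ⊆ Set.Ioo (ξ₀ - r) (ξ₀ + r) ∧ ψ ξ₀ = 1 ∧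
    Tendsto
      (fun R : ℝ => R⁻¹ * ∫ s in Set.Ioo (-R) R ∩ {s : ℝ | 0 < (((σ : ℤ) : ℝ)) * s},
        normSq2 (localFourier φ A u ψ s))
      atTop (𝓝 0)

/-- The wave front set `WF*(A û)`, with covectors measured in the coordinate `φ`. -/
def WFStar (φ : ℝ → ℝ) (A : ℝ → Matrix (Fin 2) (Fin 2) ℂ) (u : LatticeFun) : Set (ℝ × ℤˣ) :=
  {z | ¬ NotMemWF φ A u z.1 z.2}

/-- The radiation condition of sign `κ = ±1`: over the points of `M(θ)`, the
wave front set of `P₁ û` has only the direction `-κ`, that of `P₂ û` only the direction `κ`. -/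
def Radiation (φ : ℝ → ℝ) (θ : ℝ) (κ : ℤˣ) (u : LatticeFun) : Prop :=
  ∀ ξ ∈ c.fermi θ, ∀ σ : ℤˣ,
    ((ξ, σ) ∈ WFStar φ c.proj₁ u → σ = -κ) ∧ ((ξ, σ) ∈ WFStar φ c.proj₂ u → σ = κ)

end QWalk

end

/-!
The proof compares the stationary states of the perturbed walk with plane waves.

*Asymptotics.* Inside a band the symbol has the eigenvalue `e^{iθ}` at exactly two points of the
torus. The corresponding plane waves are orthogonal and non-isotropic for the conserved current
`x̄₀ y₀ - x̄₁ y₁`, with currents of opposite signs, the sign being that of the group velocity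
(`LimitCoin.exists_wavePair`). Hence on every bond a stationary state is a combination of the two
waves. The coefficients are its currents against the waves, and these vary only through the
perturbation of the coin (`current_succ_sub`), which decays exponentially while `u ∈ 𝓑*` grows at
most polynomially. So `u` is bounded and has an amplitude for each of the two waves at each end, up
to summable errors (`WavePair.exists_limits`). If both amplitudes vanish at one end, then `u = 0`
(`WavePair.eq_zero_of_tendsto_zero`).

*Wave front set.* The Fourier transform of `ψ P û` in the coordinate `φ` is a sum over `y` of
`u(y) ∫ e^{-i(yξ + sφ(ξ))} k(ξ) dξ`. Where `y` and `s φ'` have the same sign, the phase is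
non-stationary and the integral is `O((|y| + |s|)⁻²)` (`exists_norm_osc_le`), so as `|s| → ∞` only
the asymptotics of `u` on the opposite half-line matter, and there Fourier inversion evaluates the
sum over a plane wave. Taking means in `s`, an excluded direction over a point of `M(θ)` forces the
amplitude of that wave at one end to vanish (`amplitude_eq_zero_of_notMemWF`).

*Conclusion.* In the coordinate `ξ` both waves are excluded at the same end. In the coordinate
`θ(ξ)` the end depends on the sign of the group velocity, so the two waves are excluded at opposite
ends; then the conserved current has both signs, hence is zero, and the remaining amplitudes vanish
(`WavePair.limit_eq_zero_of_current`).
-/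

open Filter Topology
open scoped ContDiff

namespace QWalk

open MeasureTheory ComplexConjugate

/-! ### Oscillatory integrals -/

/-- Smooth complex amplitudes with compact support inside the set `I`. -/
structure IsAmplitude (I : Set ℝ) (k : ℝ → ℂ) : Prop where
  contDiff : ContDiff ℝ ∞ k
  hasCompactSupport : HasCompactSupport k
  tsupport_subset : tsupport k ⊆ I

namespace IsAmplitude

variable {I : Set ℝ} {k k' f : ℝ → ℂ}

theorem eq_zero (hk : IsAmplitude I k) {x : ℝ} (hx : x ∉ I) : k x = 0 :=
  image_eq_zero_of_notMem_tsupport fun h => hx (hk.tsupport_subset h)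

/-- A factor that is smooth only on `I` may be multiplied onto an amplitude. -/
theorem mul_right (hk : IsAmplitude I k) (hI : IsOpen I) (hf : ContDiffOn ℝ ∞ f I) :
    IsAmplitude I fun x => k x * f x := by
  have hsub : tsupport (fun x => k x * f x) ⊆ tsupport k := tsupport_mul_subset_left
  refine ⟨contDiff_iff_contDiffAt.2 fun x => ?_, hk.hasCompactSupport.mul_right,
    hsub.trans hk.tsupport_subset⟩
  by_cases hx : x ∈ tsupport k
  · exact hk.contDiff.contDiffAt.mul
      (hf.contDiffAt (hI.mem_nhds (hk.tsupport_subset hx)))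
  · have h0 : (fun x => k x * f x) =ᶠ[𝓝 x] fun _ => 0 := by
      filter_upwards [(isClosed_tsupport k).isOpen_compl.mem_nhds hx] with y hy
      simp [image_eq_zero_of_notMem_tsupport hy]
    exact contDiffAt_const.congr_of_eventuallyEq h0

theorem add (hk : IsAmplitude I k) (hk' : IsAmplitude I k') :
    IsAmplitude I fun x => k x + k' x := by
  refine ⟨hk.contDiff.add hk'.contDiff, hk.hasCompactSupport.add hk'.hasCompactSupport, ?_⟩
  exact (tsupport_add k k').trans (Set.union_subset hk.tsupport_subset hk'.tsupport_subset)

theorem deriv (hk : IsAmplitude I k) : IsAmplitude I (deriv k) :=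
  ⟨(contDiff_infty_iff_deriv.1 hk.contDiff).2, hk.hasCompactSupport.deriv,
    tsupport_deriv_subset.trans hk.tsupport_subset⟩

theorem integrable (hk : IsAmplitude I k) : Integrable k :=
  hk.contDiff.continuous.integrable_of_hasCompactSupport hk.hasCompactSupport

theorem exists_bound (hk : IsAmplitude I k) : ∃ B, ∀ x, ‖k x‖ ≤ B := by
  obtain ⟨B, hB⟩ := hk.contDiff.continuous.bounded_above_of_compact_support
    hk.hasCompactSupport
  exact ⟨B, hB⟩

end IsAmplitude

theorem contDiffOn_cexp_phase {I : Set ℝ} {Φ : ℝ → ℝ} (hΦ : ContDiffOn ℝ ∞ Φ I) :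
    ContDiffOn ℝ ∞ (fun ξ => Complex.exp (-Complex.I * (Φ ξ : ℂ))) I := by
  have h : ContDiffOn ℝ ∞ (fun ξ => (Φ ξ : ℂ)) I :=
    Complex.ofRealCLM.contDiff.comp_contDiffOn hΦ
  exact (contDiffOn_const.mul h).cexp

theorem norm_cexp_phase (t : ℝ) : ‖Complex.exp (-Complex.I * (t : ℂ))‖ = 1 := by
  rw [show -Complex.I * (t : ℂ) = ((-t : ℝ) : ℂ) * Complex.I by push_cast; ring]
  exact Complex.norm_exp_ofReal_mul_I _

/-- Integration by parts in an oscillatory integral without stationary points; `w` plays the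
role of `1 / Φ'`. -/
theorem integral_phase_mul {I : Set ℝ} (hI : IsOpen I) {Φ : ℝ → ℝ} {w k : ℝ → ℂ}
    (hΦ : ContDiffOn ℝ ∞ Φ I) (hw : ContDiffOn ℝ ∞ w I)
    (hwΦ : ∀ ξ ∈ I, w ξ * ((deriv Φ ξ : ℝ) : ℂ) = 1) (hk : IsAmplitude I k) :
    ∫ ξ, Complex.exp (-Complex.I * (Φ ξ : ℂ)) * k ξ =
      -Complex.I * ∫ ξ, Complex.exp (-Complex.I * (Φ ξ : ℂ)) *
        (deriv k ξ * w ξ + k ξ * deriv w ξ) := by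
  have hw' : ContDiffOn ℝ ∞ (deriv w) I := hw.deriv_of_isOpen hI (by simp)
  have hkw := hk.mul_right hI hw
  have hsum := (hk.deriv.mul_right hI hw).add (hk.mul_right hI hw')
  have hexp := contDiffOn_cexp_phase hΦ
  have hv : ∀ ξ, HasDerivAt (fun ξ => k ξ * w ξ) (deriv k ξ * w ξ + k ξ * deriv w ξ) ξ := by
    intro ξ
    by_cases hξ : ξ ∈ I
    · have h1 := (hk.contDiff.differentiable (by simp)).differentiableAt (x := ξ) |>.hasDerivAt
      have h2 := ((hw.differentiableOn (by simp)).differentiableAt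
        (hI.mem_nhds hξ)).hasDerivAt
      exact h1.mul h2
    · have h0 := HasDerivAt.of_notMem_tsupport (𝕜 := ℝ)
        (fun h => hξ (hkw.tsupport_subset h))
      simpa [hk.eq_zero hξ, hk.deriv.eq_zero hξ] using h0
  have hu : ∀ ξ ∈ I, HasDerivAt (fun ξ => Complex.exp (-Complex.I * (Φ ξ : ℂ)))
      (Complex.exp (-Complex.I * (Φ ξ : ℂ)) * (-Complex.I * ((deriv Φ ξ : ℝ) : ℂ))) ξ := by
    intro ξ hξ
    have h2 := ((hΦ.differentiableOn (by simp)).differentiableAt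
        (hI.mem_nhds hξ)).hasDerivAt
    exact (h2.ofReal_comp.const_mul (-Complex.I)).cexp
  have huv : ∀ ξ, Complex.exp (-Complex.I * (Φ ξ : ℂ)) * (-Complex.I * ((deriv Φ ξ : ℝ) : ℂ)) *
      (k ξ * w ξ) = -Complex.I * (Complex.exp (-Complex.I * (Φ ξ : ℂ)) * k ξ) := by
    intro ξ
    by_cases hξ : ξ ∈ I
    · linear_combination (-Complex.I * Complex.exp (-Complex.I * (Φ ξ : ℂ)) * k ξ) * hwΦ ξ hξ
    · simp [hk.eq_zero hξ]
  have key := integral_mul_deriv_eq_deriv_mul_of_integrable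
    (u := fun ξ => Complex.exp (-Complex.I * (Φ ξ : ℂ))) (v := fun ξ => k ξ * w ξ)
    (u' := fun ξ => Complex.exp (-Complex.I * (Φ ξ : ℂ)) * (-Complex.I * ((deriv Φ ξ : ℝ) : ℂ)))
    (v' := fun ξ => deriv k ξ * w ξ + k ξ * deriv w ξ)
    (fun ξ hξ => hu ξ (hkw.tsupport_subset hξ)) (fun ξ _ => hv ξ)
    (by rw [mul_comm]; exact (hsum.mul_right hI hexp).integrable)
    (by
      refine ((hk.mul_right hI hexp).integrable.const_mul (-Complex.I)).congr
        (Eventually.of_forall fun ξ => ?_)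
      simp only [Pi.mul_apply]
      rw [huv]; ring)
    (by rw [mul_comm]; exact (hkw.mul_right hI hexp).integrable)
  simp only [huv] at key
  rw [integral_const_mul] at key
  rw [key]
  linear_combination (∫ ξ, Complex.exp (-Complex.I * (Φ ξ : ℂ)) * k ξ) * Complex.I_mul_I

/-- The oscillatory integral `∫ e^{-i(yξ + sφ(ξ))} k(ξ) dξ`. -/
noncomputable def osc (φ : ℝ → ℝ) (k : ℝ → ℂ) (y s : ℝ) : ℂ :=
  ∫ ξ, Complex.exp (-Complex.I * ((y * ξ + s * φ ξ : ℝ) : ℂ)) * k ξ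

theorem norm_osc_le (φ : ℝ → ℝ) (k : ℝ → ℂ) (y s : ℝ) : ‖osc φ k y s‖ ≤ ∫ ξ, ‖k ξ‖ := by
  refine (norm_integral_le_integral_norm _).trans_eq ?_
  simp only [norm_mul, norm_cexp_phase, one_mul]

/-- Elementary bound for `((k w)' w)'` when `w` and its derivatives are of size `A / N`. -/
theorem norm_two_step_le {k0 k1 k2 w0 w1 w2 : ℂ} {A B N : ℝ} (hN : 0 < N)
    (h0 : ‖k0‖ ≤ B) (h1 : ‖k1‖ ≤ B) (h2 : ‖k2‖ ≤ B)
    (g0 : ‖w0‖ ≤ A / N) (g1 : ‖w1‖ ≤ A / N) (g2 : ‖w2‖ ≤ A / N) :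
    ‖(k2 * w0 + k1 * w1 + (k1 * w1 + k0 * w2)) * w0 + (k1 * w0 + k0 * w1) * w1‖ ≤
      6 * B * A ^ 2 / N ^ 2 := by
  have hB : 0 ≤ B := (norm_nonneg _).trans h0
  have hA : 0 ≤ A / N := (norm_nonneg _).trans g0
  have hm : ∀ {x y z : ℂ}, ‖x‖ ≤ B → ‖y‖ ≤ A / N → ‖z‖ ≤ A / N →
      ‖x * y * z‖ ≤ B * (A / N) * (A / N) := by
    intro x y z hx hy hz
    rw [norm_mul, norm_mul]
    gcongr
  have e : (k2 * w0 + k1 * w1 + (k1 * w1 + k0 * w2)) * w0 + (k1 * w0 + k0 * w1) * w1 =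
      k2 * w0 * w0 + k1 * w1 * w0 + k1 * w1 * w0 + k0 * w2 * w0 + k1 * w0 * w1
        + k0 * w1 * w1 := by ring
  rw [e]
  calc _ ≤ ‖k2 * w0 * w0‖ + ‖k1 * w1 * w0‖ + ‖k1 * w1 * w0‖ + ‖k0 * w2 * w0‖
        + ‖k1 * w0 * w1‖ + ‖k0 * w1 * w1‖ := by
          refine (norm_add_le _ _).trans ?_
          gcongr
          refine (norm_add_le _ _).trans ?_
          gcongr
          refine (norm_add_le _ _).trans ?_
          gcongr
          refine (norm_add_le _ _).trans ?_
          gcongr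
          exact norm_add_le _ _
    _ ≤ B * (A / N) * (A / N) + B * (A / N) * (A / N) + B * (A / N) * (A / N)
        + B * (A / N) * (A / N) + B * (A / N) * (A / N) + B * (A / N) * (A / N) := by
          gcongr
          exacts [hm h2 g0 g0, hm h1 g1 g0, hm h1 g1 g0, hm h0 g2 g0, hm h1 g0 g1, hm h0 g1 g1]
    _ = 6 * B * A ^ 2 / N ^ 2 := by field_simp; ring

/-- Non-stationary phase: as long as `y` and `s φ'` have the same sign, the derivative
`y + s φ'` of the phase is comparable to `|y| + |s|`, and two integrations by parts gain two
powers of it. -/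
theorem exists_norm_osc_le {I : Set ℝ} (hI : IsOpen I) {φ : ℝ → ℝ} {k : ℝ → ℂ} {τ : ℝ}
    (hτ : |τ| = 1) (hφ : ContDiffOn ℝ ∞ φ I) (hφ' : ∀ ξ ∈ I, 0 < τ * deriv φ ξ)
    (hk : IsAmplitude I k) :
    ∃ C, 0 ≤ C ∧ ∀ y s : ℝ, 0 ≤ τ * y * s → ‖osc φ k y s‖ ≤ C / (1 + |y| + |s|) ^ 2 := by
  have hd1 : ContDiffOn ℝ ∞ (deriv φ) I := hφ.deriv_of_isOpen hI (by simp)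
  have hd2 : ContDiffOn ℝ ∞ (deriv (deriv φ)) I := hd1.deriv_of_isOpen hI (by simp)
  have hd3 : ContDiffOn ℝ ∞ (deriv (deriv (deriv φ))) I := hd2.deriv_of_isOpen hI (by simp)
  have hne : ∀ ξ ∈ I, deriv φ ξ ≠ 0 := fun ξ hξ h => by
    have := hφ' ξ hξ; simp [h] at this
  set S := tsupport k
  have hS : IsCompact S := hk.hasCompactSupport
  obtain ⟨b1, hb1⟩ := hS.exists_bound_of_continuousOn
    ((hd1.continuousOn.mono hk.tsupport_subset).inv₀ fun ξ hξ => hne ξ (hk.tsupport_subset hξ))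
  obtain ⟨b2, hb2⟩ := hS.exists_bound_of_continuousOn (hd2.continuousOn.mono hk.tsupport_subset)
  obtain ⟨b3, hb3⟩ := hS.exists_bound_of_continuousOn (hd3.continuousOn.mono hk.tsupport_subset)
  obtain ⟨c0, hc0⟩ := hk.exists_bound
  obtain ⟨c1, hc1⟩ := hk.deriv.exists_bound
  obtain ⟨c2, hc2⟩ := hk.deriv.deriv.exists_bound
  set b := max 1 (max b1 (max b2 b3))
  have hb : 1 ≤ b := le_max_left _ _
  have hb1' : b1 ≤ b := (le_max_left _ _).trans (le_max_right _ _)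
  have hb2' : b2 ≤ b :=
    (le_max_left _ _).trans ((le_max_right _ _).trans (le_max_right _ _))
  have hb3' : b3 ≤ b :=
    (le_max_right _ _).trans ((le_max_right _ _).trans (le_max_right _ _))
  set B := max c0 (max c1 c2)
  have hB0 : c0 ≤ B := le_max_left _ _
  have hB1 : c1 ≤ B := (le_max_left _ _).trans (le_max_right _ _)
  have hB2 : c2 ≤ B := (le_max_right _ _).trans (le_max_right _ _)
  have hB : 0 ≤ B := ((norm_nonneg _).trans (hc0 0)).trans hB0
  set A := 3 * b ^ 5
  have hbp : b ≤ b ^ 5 := le_self_pow₀ hb (by norm_num)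
  have hbp3 : b ^ 3 ≤ b ^ 5 := pow_le_pow_right₀ hb (by norm_num)
  have hlarge : ∀ y s : ℝ, 0 ≤ τ * y * s → 0 < |y| + |s| →
      ‖osc φ k y s‖ ≤ 6 * B * A ^ 2 / (|y| + |s|) ^ 2 * volume.real S := by
    intro y s hys hN
    set N := |y| + |s|
    have hsN : |s| ≤ N := le_add_of_nonneg_left (abs_nonneg y)
    -- on `I` there is no cancellation between `y` and `s φ'`
    have hDabs : ∀ ξ ∈ I, |y + s * deriv φ ξ| = |y| + |s| * |deriv φ ξ| := by
      intro ξ hξ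
      have h1 : 0 ≤ y * (s * deriv φ ξ) := by
        have h2 : 0 ≤ (τ * y * s) * (τ * deriv φ ξ) := mul_nonneg hys (hφ' ξ hξ).le
        have h3 : τ * τ = 1 := by rw [← abs_mul_abs_self, hτ, one_mul]
        calc 0 ≤ (τ * y * s) * (τ * deriv φ ξ) := h2
          _ = (τ * τ) * (y * (s * deriv φ ξ)) := by ring
          _ = _ := by rw [h3, one_mul]
      rw [← abs_mul]
      exact (abs_add_eq_add_abs_iff _ _).2 (mul_nonneg_iff.1 h1)
    set D : ℝ → ℝ := fun ξ => y + s * deriv φ ξ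
    have hDpos : ∀ ξ ∈ I, 0 < |D ξ| := by
      intro ξ hξ
      have h1 := abs_pos.2 (hne ξ hξ)
      rw [hDabs ξ hξ]
      rcases (abs_nonneg y).lt_or_eq with h | h
      · positivity
      · have : 0 < |s| := by linarith
        positivity
    have hDne : ∀ ξ ∈ I, D ξ ≠ 0 := fun ξ hξ => abs_pos.1 (hDpos ξ hξ)
    have hDs : ContDiffOn ℝ ∞ D I := contDiffOn_const.add (contDiffOn_const.mul hd1)
    set v : ℝ → ℝ := fun ξ => (D ξ)⁻¹
    have hvs : ContDiffOn ℝ ∞ v I := hDs.inv hDne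
    have hD' : ∀ ξ ∈ I, HasDerivAt D (s * deriv (deriv φ) ξ) ξ := fun ξ hξ =>
      ((((hd1.differentiableOn (by simp)).differentiableAt
        (hI.mem_nhds hξ)).hasDerivAt).const_mul s).const_add y
    have hv' : ∀ ξ ∈ I, HasDerivAt v (-(s * deriv (deriv φ) ξ) * v ξ ^ 2) ξ := by
      intro ξ hξ
      refine ((hD' ξ hξ).inv (hDne ξ hξ)).congr_deriv ?_
      simp only [v]; field_simp
    have hdv : ∀ ξ ∈ I, deriv v ξ = -(s * deriv (deriv φ) ξ) * v ξ ^ 2 :=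
      fun ξ hξ => (hv' ξ hξ).deriv
    have hv'' : ∀ ξ ∈ I, HasDerivAt (deriv v) (-(s * deriv (deriv (deriv φ)) ξ) * v ξ ^ 2
        + 2 * (s * deriv (deriv φ) ξ) ^ 2 * v ξ ^ 3) ξ := by
      intro ξ hξ
      have h1 : HasDerivAt (fun ξ => -(s * deriv (deriv φ) ξ) * v ξ ^ 2) _ ξ :=
        ((((hd2.differentiableOn (by simp)).differentiableAt
          (hI.mem_nhds hξ)).hasDerivAt.const_mul s).neg).mul ((hv' ξ hξ).pow 2)
      refine (h1.congr_of_eventuallyEq ?_).congr_deriv ?_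
      · filter_upwards [hI.mem_nhds hξ] with z hz using hdv z hz
      · simp only [Pi.neg_apply]; push_cast; ring
    set w : ℝ → ℂ := fun ξ => (v ξ : ℂ)
    have hws : ContDiffOn ℝ ∞ w I := Complex.ofRealCLM.contDiff.comp_contDiffOn hvs
    have hws' : ContDiffOn ℝ ∞ (deriv w) I := hws.deriv_of_isOpen hI (by simp)
    have hdw : ∀ ξ ∈ I, deriv w ξ = ((deriv v ξ : ℝ) : ℂ) := fun ξ hξ => by
      rw [hdv ξ hξ]; exact (hv' ξ hξ).ofReal_comp.deriv
    have hddw : ∀ ξ ∈ I, deriv (deriv w) ξ = ((deriv (deriv v) ξ : ℝ) : ℂ) := fun ξ hξ => by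
      rw [(hv'' ξ hξ).deriv]
      refine ((hv'' ξ hξ).ofReal_comp.congr_of_eventuallyEq ?_).deriv
      filter_upwards [hI.mem_nhds hξ] with z hz using hdw z hz
    have hΦ : ContDiffOn ℝ ∞ (fun ξ => y * ξ + s * φ ξ) I :=
      (contDiffOn_const.mul contDiffOn_id).add (contDiffOn_const.mul hφ)
    have hwΦ : ∀ ξ ∈ I, w ξ * ((deriv (fun ξ => y * ξ + s * φ ξ) ξ : ℝ) : ℂ) = 1 := by
      intro ξ hξ
      have h1 : HasDerivAt (fun ξ => y * ξ + s * φ ξ) (y * 1 + s * deriv φ ξ) ξ :=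
        ((hasDerivAt_id ξ).const_mul y).add (((hφ.differentiableOn (by simp)).differentiableAt
          (hI.mem_nhds hξ)).hasDerivAt.const_mul s)
      rw [h1.deriv, mul_one, ← Complex.ofReal_mul]
      exact_mod_cast inv_mul_cancel₀ (hDne ξ hξ)
    have hk1 := (hk.deriv.mul_right hI hws).add (hk.mul_right hI hws')
    have e1 := integral_phase_mul hI hΦ hws hwΦ hk
    rw [integral_phase_mul hI hΦ hws hwΦ hk1] at e1
    have e2 : ‖osc φ k y s‖ = ‖∫ ξ, Complex.exp (-Complex.I * ((y * ξ + s * φ ξ : ℝ) : ℂ)) *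
        (deriv (fun x => deriv k x * w x + k x * deriv w x) ξ * w ξ +
          (deriv k ξ * w ξ + k ξ * deriv w ξ) * deriv w ξ)‖ := by
      rw [osc, e1, norm_mul, norm_mul]; simp
    rw [e2, ← setIntegral_eq_integral_of_forall_compl_eq_zero (s := S)]
    · refine norm_setIntegral_le_of_norm_le_const hS.measure_lt_top fun ξ hξ => ?_
      have hξI := hk.tsupport_subset hξ
      have hder : deriv (fun x => deriv k x * w x + k x * deriv w x) ξ =
          deriv (deriv k) ξ * w ξ + deriv k ξ * deriv w ξ +
            (deriv k ξ * deriv w ξ + k ξ * deriv (deriv w) ξ) := by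
        have hk0 := ((hk.contDiff.differentiable (by simp)).differentiableAt (x := ξ)).hasDerivAt
        have hk1 := ((hk.deriv.contDiff.differentiable (by simp)).differentiableAt
          (x := ξ)).hasDerivAt
        have hw0 := ((hws.differentiableOn (by simp)).differentiableAt
          (hI.mem_nhds hξI)).hasDerivAt
        have hw1 := ((hws'.differentiableOn (by simp)).differentiableAt
          (hI.mem_nhds hξI)).hasDerivAt
        exact ((hk1.mul hw0).add (hk0.mul hw1)).deriv
      rw [norm_mul, norm_cexp_phase, one_mul, hder]
      have hvb : |v ξ| ≤ b / N := by
        have h1 : ‖(deriv φ ξ)⁻¹‖ ≤ b := (hb1 ξ hξ).trans hb1'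
        rw [norm_inv, Real.norm_eq_abs] at h1
        have h2 : 0 < |deriv φ ξ| := abs_pos.2 (hne ξ hξI)
        have h3 : 1 ≤ b * |deriv φ ξ| := by
          rw [inv_le_iff_one_le_mul₀ h2] at h1; linarith
        simp only [v]
        rw [abs_inv, inv_le_comm₀ (hDpos ξ hξI) (by positivity), inv_div, hDabs ξ hξI,
          div_le_iff₀ (by positivity)]
        have h4 : |y| * 1 ≤ |y| * b := by gcongr
        have h5 : |s| * 1 ≤ |s| * (b * |deriv φ ξ|) := by gcongr
        simp only [N]
        linarith
      have hp2 : |deriv (deriv φ) ξ| ≤ b := (hb2 ξ hξ).trans hb2'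
      have hp3 : |deriv (deriv (deriv φ)) ξ| ≤ b := (hb3 ξ hξ).trans hb3'
      refine norm_two_step_le hN ((hc0 ξ).trans hB0) ((hc1 ξ).trans hB1)
        ((hc2 ξ).trans hB2) ?_ ?_ ?_
      · simp only [w, Complex.norm_real, Real.norm_eq_abs]
        refine hvb.trans ?_
        gcongr
        simp only [A]; linarith
      · rw [hdw ξ hξI, hdv ξ hξI, Complex.norm_real, Real.norm_eq_abs, abs_mul, abs_neg, abs_mul,
          abs_pow]
        calc |s| * |deriv (deriv φ) ξ| * |v ξ| ^ 2 ≤ N * b * (b / N) ^ 2 := by gcongr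
          _ = b ^ 3 / N := by field_simp
          _ ≤ A / N := by gcongr; simp only [A]; linarith
      · rw [hddw ξ hξI, (hv'' ξ hξI).deriv, Complex.norm_real, Real.norm_eq_abs]
        calc _ ≤ |s| * |deriv (deriv (deriv φ)) ξ| * |v ξ| ^ 2
              + 2 * (|s| * |deriv (deriv φ) ξ|) ^ 2 * |v ξ| ^ 3 := by
              refine (abs_add_le _ _).trans_eq ?_
              simp only [abs_mul, abs_neg, abs_pow, Nat.abs_ofNat]
          _ ≤ N * b * (b / N) ^ 2 + 2 * (N * b) ^ 2 * (b / N) ^ 3 := by gcongr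
          _ = (b ^ 3 + 2 * b ^ 5) / N := by field_simp
          _ ≤ A / N := by gcongr; simp only [A]; linarith
    · intro ξ hξ
      have h0 : k ξ = 0 := image_eq_zero_of_notMem_tsupport hξ
      have h1 : deriv k ξ = 0 :=
        image_eq_zero_of_notMem_tsupport fun h => hξ (tsupport_deriv_subset h)
      have h2 : deriv (fun x => deriv k x * w x + k x * deriv w x) ξ = 0 := by
        refine image_eq_zero_of_notMem_tsupport fun h => hξ ?_
        refine ((tsupport_add (fun x => deriv k x * w x) fun x => k x * deriv w x).trans
          (Set.union_subset ?_ ?_)) (tsupport_deriv_subset h)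
        · exact (tsupport_mul_subset_left (f := deriv k)).trans tsupport_deriv_subset
        · exact tsupport_mul_subset_left (f := k)
      simp [h0, h1, h2]
  refine ⟨4 * (6 * B * A ^ 2 * volume.real S) + 4 * ∫ ξ, ‖k ξ‖, by positivity,
    fun y s hys => ?_⟩
  have hint : 0 ≤ ∫ ξ, ‖k ξ‖ := integral_nonneg fun _ => norm_nonneg _
  have hpos : 0 ≤ 6 * B * A ^ 2 * volume.real S := by positivity
  have hy := abs_nonneg y
  have hs := abs_nonneg s
  rw [le_div_iff₀ (by positivity)]
  rcases le_or_gt 1 (|y| + |s|) with h | h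
  · have h1 := hlarge y s hys (by linarith)
    have h2 : (1 + |y| + |s|) ^ 2 ≤ 4 * (|y| + |s|) ^ 2 := by nlinarith
    calc _ ≤ 6 * B * A ^ 2 / (|y| + |s|) ^ 2 * volume.real S * (4 * (|y| + |s|) ^ 2) := by
          gcongr
      _ = 4 * (6 * B * A ^ 2 * volume.real S) := by
          have : (|y| + |s|) ≠ 0 := by linarith
          field_simp
      _ ≤ _ := by linarith
  · have h1 := norm_osc_le φ k y s
    have h2 : (1 + |y| + |s|) ^ 2 ≤ 4 := by nlinarith
    calc _ ≤ (∫ ξ, ‖k ξ‖) * 4 := by gcongr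
      _ ≤ _ := by linarith

/-! ### Sums over the lattice -/

theorem osc_eq_right (φ φ' : ℝ → ℝ) (k : ℝ → ℂ) (y s : ℝ) :
    osc φ k y s = osc φ' (fun ξ => k ξ * Complex.exp (-Complex.I * ((s * φ ξ : ℝ) : ℂ))) y 0 := by
  refine integral_congr_ae (Eventually.of_forall fun ξ => ?_)
  simp only [Complex.ofReal_add, mul_add, Complex.exp_add, zero_mul, add_zero]
  ring

theorem osc_eq_left (φ : ℝ → ℝ) (k : ℝ → ℂ) (y s : ℝ) :
    osc φ k y s = osc φ (fun ξ => k ξ * Complex.exp (-Complex.I * ((y * ξ : ℝ) : ℂ))) 0 s := by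
  refine integral_congr_ae (Eventually.of_forall fun ξ => ?_)
  simp only [Complex.ofReal_add, mul_add, Complex.exp_add, zero_mul, zero_add]
  ring

theorem summable_one_div_one_add_abs_sq : Summable fun y : ℤ => 1 / (1 + |(y : ℝ)|) ^ 2 := by
  have h : Summable fun n : ℕ => 1 / (1 + (n : ℝ)) ^ 2 := by
    have := (summable_nat_add_iff 1).2 (Real.summable_one_div_nat_pow.2 (one_lt_two))
    refine this.congr fun n => ?_
    push_cast; ring_nf
  refine Summable.of_nat_of_neg ?_ ?_ <;> simpa using h

section

variable {I : Set ℝ} {φ : ℝ → ℝ} {k : ℝ → ℂ}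

theorem continuous_osc (hI : IsOpen I) (hφ : ContDiffOn ℝ ∞ φ I) (hk : IsAmplitude I k) (y : ℝ) :
    Continuous fun s => osc φ k y s := by
  refine continuous_of_dominated (bound := fun ξ => ‖k ξ‖) (fun s => ?_) (fun s => ?_)
    hk.integrable.norm (Eventually.of_forall fun ξ => by fun_prop)
  · have hΦ : ContDiffOn ℝ ∞ (fun ξ => y * ξ + s * φ ξ) I :=
      (contDiffOn_const.mul contDiffOn_id).add (contDiffOn_const.mul hφ)
    have := (hk.mul_right hI (contDiffOn_cexp_phase hΦ)).integrable.aestronglyMeasurable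
    simpa only [mul_comm] using this
  · exact Eventually.of_forall fun ξ => by rw [norm_mul, norm_cexp_phase, one_mul]

theorem summable_norm_osc (hI : IsOpen I) (hφ : ContDiffOn ℝ ∞ φ I) (hk : IsAmplitude I k)
    (s : ℝ) : Summable fun y : ℤ => ‖osc φ k y s‖ := by
  have hk' := hk.mul_right hI (contDiffOn_cexp_phase (contDiffOn_const (c := s) |>.mul hφ))
  obtain ⟨C, -, hC⟩ := exists_norm_osc_le (τ := 1) hI (by simp) (contDiffOn_id (𝕜 := ℝ) (n := ∞))
    (by simp) hk'
  refine Summable.of_nonneg_of_le (fun _ => norm_nonneg _) (fun y => ?_)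
    (summable_one_div_one_add_abs_sq.mul_left C)
  rw [osc_eq_right φ id]
  refine (hC y 0 (by simp)).trans_eq ?_
  simp [div_eq_mul_inv]

/-- The Riemann–Lebesgue lemma with the phase `φ`. -/
theorem tendsto_osc (hI : IsOpen I) (hφ : ContDiffOn ℝ ∞ φ I) {τ σ : ℝ} (hτ : |τ| = 1)
    (hσ : |σ| = 1) (hφ' : ∀ ξ ∈ I, 0 < τ * deriv φ ξ) (hk : IsAmplitude I k) (y : ℝ) :
    Tendsto (fun t => osc φ k y (σ * t)) atTop (𝓝 0) := by
  have hk' := hk.mul_right hI (contDiffOn_cexp_phase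
    (contDiffOn_const (c := y) |>.mul contDiffOn_id))
  obtain ⟨C, -, hC⟩ := exists_norm_osc_le hI hτ hφ hφ' hk'
  have h1 : Tendsto (fun t : ℝ => C / (1 + t) ^ 2) atTop (𝓝 0) :=
    ((tendsto_pow_atTop two_ne_zero).comp
      (tendsto_atTop_add_const_left _ 1 tendsto_id)).const_div_atTop C
  refine squeeze_zero_norm' ?_ h1
  filter_upwards [eventually_ge_atTop 0] with t ht
  rw [osc_eq_left]
  refine (hC 0 (σ * t) (by simp)).trans_eq ?_
  simp [abs_mul, hσ, abs_of_nonneg ht]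

/-- A bounded sequence that is summable on the half-line `στy < 0` contributes a function of
`s = σt`, `t ≥ 0`, that is continuous, bounded and decays: on `στy ≥ 0` the phase is
non-stationary. -/
theorem tsum_osc_decay (hI : IsOpen I) (hφ : ContDiffOn ℝ ∞ φ I) {τ σ : ℝ} (hτ : |τ| = 1)
    (hσ : |σ| = 1) (hφ' : ∀ ξ ∈ I, 0 < τ * deriv φ ξ) (hk : IsAmplitude I k)
    {e : ℤ → ℂ} {B : ℝ} (hB : ∀ y, ‖e y‖ ≤ B)
    (he : Summable fun y : ℤ => if σ * τ * y < 0 then ‖e y‖ else 0) :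
    ContinuousOn (fun t : ℝ => ∑' y : ℤ, e y * osc φ k y (σ * t)) (Set.Ici 0) ∧
    (∃ D, ∀ t ∈ Set.Ici (0 : ℝ), ‖∑' y : ℤ, e y * osc φ k y (σ * t)‖ ≤ D) ∧
    Tendsto (fun t : ℝ => ∑' y : ℤ, e y * osc φ k y (σ * t)) atTop (𝓝 0) := by
  obtain ⟨C, hC0, hC⟩ := exists_norm_osc_le hI hτ hφ hφ' hk
  have hB0 : 0 ≤ B := (norm_nonneg _).trans (hB 0)
  set bound : ℤ → ℝ := fun y => B * C * (1 / (1 + |(y : ℝ)|) ^ 2) +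
    (if σ * τ * y < 0 then ‖e y‖ else 0) * ∫ ξ, ‖k ξ‖
  have hsum : Summable bound :=
    (summable_one_div_one_add_abs_sq.mul_left _).add (he.mul_right _)
  have hbound : ∀ (y : ℤ), ∀ t ∈ Set.Ici (0 : ℝ), ‖e y * osc φ k y (σ * t)‖ ≤ bound y := by
    intro y t ht
    rw [norm_mul]
    by_cases hy : σ * τ * y < 0
    · simp only [bound, if_pos hy]
      have h1 := mul_le_mul_of_nonneg_left (norm_osc_le φ k y (σ * t)) (norm_nonneg (e y))
      have h2 : 0 ≤ B * C * (1 / (1 + |(y : ℝ)|) ^ 2) := by positivity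
      linarith
    · simp only [bound, if_neg hy, zero_mul, add_zero]
      have h1 : ‖osc φ k y (σ * t)‖ ≤ C / (1 + |(y : ℝ)|) ^ 2 := by
        refine (hC y (σ * t) ?_).trans ?_
        · have := mul_nonneg (not_lt.1 hy) (Set.mem_Ici.1 ht)
          linarith
        · refine div_le_div_of_nonneg_left hC0 (by positivity) (pow_le_pow_left₀ (by positivity) ?_ 2)
          linarith [abs_nonneg (σ * t)]
      calc ‖e y‖ * ‖osc φ k y (σ * t)‖ ≤ B * (C / (1 + |(y : ℝ)|) ^ 2) := by
            gcongr; exact hB y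
        _ = _ := by ring
  refine ⟨continuousOn_tsum (fun y => ?_) hsum hbound, ⟨∑' y, bound y, fun t ht => ?_⟩, ?_⟩
  · exact (continuous_const.mul ((continuous_osc hI hφ hk y).comp
      (continuous_const.mul continuous_id))).continuousOn
  · exact tsum_of_norm_bounded hsum.hasSum fun y => hbound y t ht
  · have h0 : (0 : ℂ) = ∑' _ : ℤ, (0 : ℂ) := by simp
    rw [h0]
    refine tendsto_tsum_of_dominated_convergence hsum (fun y => ?_) ?_
    · simpa using (tendsto_osc hI hφ hτ hσ hφ' hk y).const_mul (e y)
    · filter_upwards [eventually_ge_atTop 0] with t ht y using hbound y t ht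

end

/-! ### Fourier inversion and means -/

/-- Fourier inversion on the circle, for functions supported in one period. -/
theorem tsum_exp_mul_integral {ξ₀ : ℝ} {g : ℝ → ℂ}
    (hg : IsAmplitude (Set.Ioo (ξ₀ - Real.pi) (ξ₀ + Real.pi)) g) {ζ : ℝ}
    (hζ : ζ ∈ Set.Icc (ξ₀ - Real.pi) (ξ₀ + Real.pi)) :
    ∑' y : ℤ, Complex.exp (Complex.I * ((y * ζ : ℝ) : ℂ)) *
      ∫ ξ, Complex.exp (-Complex.I * ((y * ξ : ℝ) : ℂ)) * g ξ = 2 * Real.pi * g ζ := by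
  have hpi := Real.pi_pos
  have h2pi : (2 * Real.pi) ≠ 0 := by positivity
  have hf1 : ContDiff ℝ ∞ fun t : ℝ => g (2 * Real.pi * t) :=
    hg.contDiff.comp (contDiff_const.mul contDiff_id)
  have hf2 : HasCompactSupport fun t : ℝ => g (2 * Real.pi * t) :=
    hg.hasCompactSupport.comp_homeomorph (Homeomorph.mulLeft₀ _ h2pi)
  have key := SchwartzMap.tsum_eq_tsum_fourier (hf2.toSchwartzMap hf1) (ζ / (2 * Real.pi))
  have hl : ∑' n : ℤ, (hf2.toSchwartzMap hf1) (ζ / (2 * Real.pi) + n) = g ζ := by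
    rw [tsum_eq_single 0]
    · change g (2 * Real.pi * (ζ / (2 * Real.pi) + ((0 : ℤ) : ℝ))) = g ζ
      congr 1; push_cast; field_simp; ring
    · intro n hn
      change g (2 * Real.pi * (ζ / (2 * Real.pi) + (n : ℝ))) = 0
      rw [show 2 * Real.pi * (ζ / (2 * Real.pi) + (n : ℝ)) = ζ + 2 * Real.pi * n by field_simp]
      refine hg.eq_zero fun h => ?_
      rcases lt_or_gt_of_ne hn with h' | h'
      · have : (n : ℝ) ≤ -1 := by exact_mod_cast Int.le_sub_one_of_lt h'
        nlinarith [h.1, hζ.2]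
      · have : (1 : ℝ) ≤ n := by exact_mod_cast h'
        nlinarith [h.2, hζ.1]
  rw [hl] at key
  rw [key, ← tsum_mul_left]
  refine tsum_congr fun n => ?_
  rw [SchwartzMap.fourier_coe, Real.fourier_eq', fourier_coe_apply]
  have hcv := Measure.integral_comp_mul_left
    (fun ξ => Complex.exp (-Complex.I * ((n * ξ : ℝ) : ℂ)) * g ξ) (2 * Real.pi)
  have e1 : ∫ v : ℝ, Complex.exp (((-2 * Real.pi * inner ℝ v (n : ℝ) : ℝ) : ℂ) * Complex.I) •
      (hf2.toSchwartzMap hf1) v =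
      ∫ x : ℝ, Complex.exp (-Complex.I * ((n * (2 * Real.pi * x) : ℝ) : ℂ)) *
        g (2 * Real.pi * x) := by
    refine integral_congr_ae (Eventually.of_forall fun v => ?_)
    simp only [smul_eq_mul]
    change _ * g (2 * Real.pi * v) = _
    congr 2
    simp; ring
  rw [e1, hcv, abs_of_pos (by positivity)]
  have e2 : Complex.exp (2 * Real.pi * Complex.I * n * ((ζ / (2 * Real.pi) : ℝ) : ℂ) / (1 : ℝ)) =
      Complex.exp (Complex.I * ((n * ζ : ℝ) : ℂ)) := by
    congr 1
    push_cast
    have : (Real.pi : ℂ) ≠ 0 := by exact_mod_cast hpi.ne'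
    field_simp
  rw [e2, Complex.real_smul]
  have : (Real.pi : ℂ) ≠ 0 := by exact_mod_cast hpi.ne'
  push_cast
  field_simp

/-- A plane wave turns into a value of the amplitude on the circle. -/
theorem tsum_planeWave_mul_osc {ξ₀ r : ℝ} (hr : r ≤ Real.pi) {φ : ℝ → ℝ} {k : ℝ → ℂ}
    (hφ : ContDiffOn ℝ ∞ φ (Set.Ioo (ξ₀ - r) (ξ₀ + r)))
    (hk : IsAmplitude (Set.Ioo (ξ₀ - r) (ξ₀ + r)) k) {ζ : ℝ}
    (hζ : ζ ∈ Set.Icc (ξ₀ - Real.pi) (ξ₀ + Real.pi)) (s : ℝ) :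
    ∑' y : ℤ, Complex.exp (Complex.I * ((y * ζ : ℝ) : ℂ)) * osc φ k y s =
      2 * Real.pi * (k ζ * Complex.exp (-Complex.I * ((s * φ ζ : ℝ) : ℂ))) := by
  have hk' := hk.mul_right isOpen_Ioo
    (contDiffOn_cexp_phase (contDiffOn_const (c := s) |>.mul hφ))
  have hk'' : IsAmplitude (Set.Ioo (ξ₀ - Real.pi) (ξ₀ + Real.pi)) _ :=
    ⟨hk'.contDiff, hk'.hasCompactSupport, hk'.tsupport_subset.trans
      (Set.Ioo_subset_Ioo (by linarith) (by linarith))⟩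
  rw [← tsum_exp_mul_integral hk'' hζ]
  refine tsum_congr fun y => ?_
  rw [osc_eq_right φ id]
  simp [osc]

/-- The coefficient of a frequency is recovered from means, hence vanishes when the mean square
does. -/
theorem coeff_eq_zero_of_meanSq {F E : ℝ → ℂ} {c₀ c₁ : ℂ} {ω₀ ω₁ : ℝ}
    (hF : ∀ t, 0 ≤ t → F t = c₀ * Complex.exp (-Complex.I * ((t * ω₀ : ℝ) : ℂ)) +
      c₁ * Complex.exp (-Complex.I * ((t * ω₁ : ℝ) : ℂ)) + E t)
    (hEc : ContinuousOn E (Set.Ici 0)) (hEb : ∃ D, ∀ t ∈ Set.Ici (0 : ℝ), ‖E t‖ ≤ D)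
    (hE0 : Tendsto E atTop (𝓝 0)) (hω : ω₀ ≠ ω₁ ∨ c₁ = 0)
    (hm : Tendsto (fun R : ℝ => R⁻¹ * ∫ t in Set.Ioo 0 R, ‖F t‖ ^ 2) atTop (𝓝 0)) :
    c₀ = 0 := by
  obtain ⟨D, hD⟩ := hEb
  set e₀ : ℝ → ℂ := fun t => Complex.exp (-Complex.I * ((-(t * ω₀) : ℝ) : ℂ))
  have he₀c : Continuous e₀ := by fun_prop
  have he₀ : ∀ t, ‖e₀ t‖ = 1 := fun t => norm_cexp_phase _
  have hFc : ContinuousOn F (Set.Ici 0) := by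
    refine ContinuousOn.congr (f := fun t => c₀ * Complex.exp (-Complex.I * ((t * ω₀ : ℝ) : ℂ)) +
      c₁ * Complex.exp (-Complex.I * ((t * ω₁ : ℝ) : ℂ)) + E t) ?_ fun t ht => hF t ht
    refine ContinuousOn.add (Continuous.continuousOn (by fun_prop)) hEc
  have hmaps : ∀ R : ℝ, 0 ≤ R → Set.MapsTo (fun t => R * t) (Set.uIcc 0 1) (Set.Ici 0) := by
    intro R hR t ht
    rw [Set.uIcc_of_le zero_le_one] at ht
    exact mul_nonneg hR ht.1
  have hgc : ∀ {g : ℝ → ℂ}, ContinuousOn g (Set.Ici 0) → ∀ R : ℝ, 0 ≤ R →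
      ContinuousOn (fun t => e₀ (R * t) * g (R * t)) (Set.uIcc 0 1) := fun hg R hR =>
    (he₀c.comp (continuous_const.mul continuous_id)).continuousOn.mul
      (hg.comp (continuous_const.mul continuous_id).continuousOn (hmaps R hR))
  -- the mean of `e₀ F` tends to `c₀`
  have hlim : Tendsto (fun R : ℝ => ∫ t in (0 : ℝ)..1, e₀ (R * t) * F (R * t)) atTop (𝓝 c₀) := by
    have h1 : Tendsto (fun R : ℝ => ∫ t in (0 : ℝ)..1, e₀ (R * t) * E (R * t)) atTop (𝓝 0) := by
      have h0 : (0 : ℂ) = ∫ t in (0 : ℝ)..1, (0 : ℂ) := by simp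
      rw [h0]
      refine intervalIntegral.tendsto_integral_filter_of_dominated_convergence (fun _ => D) ?_ ?_
        intervalIntegrable_const ?_
      · filter_upwards [eventually_ge_atTop 0] with R hR
        exact ((hgc hEc R hR).mono Set.uIoc_subset_uIcc).aestronglyMeasurable
          measurableSet_uIoc
      · filter_upwards [eventually_ge_atTop 0] with R hR
        refine Eventually.of_forall fun t ht => ?_
        rw [norm_mul, he₀, one_mul]
        exact hD _ (hmaps R hR (Set.uIoc_subset_uIcc ht))
      · refine Eventually.of_forall fun t ht => ?_
        rw [Set.uIoc_of_le zero_le_one] at ht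
        have h2 : Tendsto (fun R : ℝ => E (R * t)) atTop (𝓝 0) :=
          hE0.comp (tendsto_id.atTop_mul_const ht.1)
        rw [tendsto_zero_iff_norm_tendsto_zero] at h2 ⊢
        simpa [norm_mul, he₀] using h2
    have h2 : Tendsto (fun R : ℝ => c₁ * ∫ t in (0 : ℝ)..1,
        Complex.exp (-Complex.I * ((R * t * (ω₁ - ω₀) : ℝ) : ℂ))) atTop (𝓝 0) := by
      rcases hω with hω | rfl
      · have hν : ω₁ - ω₀ ≠ 0 := sub_ne_zero.2 hω.symm
        rw [show (0 : ℂ) = c₁ * 0 by simp]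
        refine Tendsto.const_mul _ ?_
        have h3 : Tendsto (fun R : ℝ => 2 / |ω₁ - ω₀| * R⁻¹) atTop (𝓝 0) := by
          simpa using tendsto_inv_atTop_zero.const_mul (2 / |ω₁ - ω₀|)
        refine squeeze_zero_norm' ?_ h3
        filter_upwards [eventually_gt_atTop 0] with R hR
        have hc : -Complex.I * ((R * (ω₁ - ω₀) : ℝ) : ℂ) ≠ 0 := by
          refine mul_ne_zero (neg_ne_zero.2 Complex.I_ne_zero) ?_
          exact_mod_cast mul_ne_zero hR.ne' hν
        have h4 : ∫ t in (0 : ℝ)..1, Complex.exp (-Complex.I * ((R * t * (ω₁ - ω₀) : ℝ) : ℂ)) =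
            ∫ t in (0 : ℝ)..1, Complex.exp ((-Complex.I * ((R * (ω₁ - ω₀) : ℝ) : ℂ)) * t) := by
          congr 1; ext t; congr 1; push_cast; ring
        rw [h4, integral_exp_mul_complex hc, norm_div, norm_mul, norm_neg, Complex.norm_I, one_mul,
          Complex.norm_real, Real.norm_eq_abs, abs_mul, abs_of_pos hR]
        have h5 : ‖Complex.exp (-Complex.I * ((R * (ω₁ - ω₀) : ℝ) : ℂ) * ((1 : ℝ) : ℂ)) -
            Complex.exp (-Complex.I * ((R * (ω₁ - ω₀) : ℝ) : ℂ) * ((0 : ℝ) : ℂ))‖ ≤ 2 := by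
          refine (norm_sub_le _ _).trans ?_
          simp only [Complex.ofReal_one, mul_one, Complex.ofReal_zero, mul_zero, Complex.exp_zero,
            norm_cexp_phase, norm_one]
          norm_num
        have h6 : 0 < |ω₁ - ω₀| := abs_pos.2 hν
        calc _ ≤ 2 / (R * |ω₁ - ω₀|) := by gcongr
          _ = _ := by field_simp
      · simp
    have h3 := (tendsto_const_nhds (x := c₀)).add (h2.add h1)
    rw [add_zero, add_zero] at h3
    refine h3.congr' ?_
    filter_upwards [eventually_ge_atTop 0] with R hR
    have e1 : ∀ t ∈ Set.uIcc (0 : ℝ) 1, e₀ (R * t) * F (R * t) =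
        c₀ + (c₁ * Complex.exp (-Complex.I * ((R * t * (ω₁ - ω₀) : ℝ) : ℂ)) +
          e₀ (R * t) * E (R * t)) := by
      intro t ht
      rw [hF _ (hmaps R hR ht)]
      have e2 : e₀ (R * t) * Complex.exp (-Complex.I * ((R * t * ω₀ : ℝ) : ℂ)) = 1 := by
        simp only [e₀]
        rw [← Complex.exp_add, ← Complex.exp_zero]; congr 1; push_cast; ring
      have e3 : e₀ (R * t) * Complex.exp (-Complex.I * ((R * t * ω₁ : ℝ) : ℂ)) =
          Complex.exp (-Complex.I * ((R * t * (ω₁ - ω₀) : ℝ) : ℂ)) := by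
        simp only [e₀]
        rw [← Complex.exp_add]; congr 1; push_cast; ring
      linear_combination c₀ * e2 + c₁ * e3
    have hi1 : IntervalIntegrable (fun t : ℝ => c₁ *
        Complex.exp (-Complex.I * ((R * t * (ω₁ - ω₀) : ℝ) : ℂ))) volume 0 1 :=
      Continuous.intervalIntegrable (by fun_prop) _ _
    have hi2 : IntervalIntegrable (fun t : ℝ => e₀ (R * t) * E (R * t)) volume 0 1 :=
      (hgc hEc R hR).intervalIntegrable
    rw [intervalIntegral.integral_congr e1, intervalIntegral.integral_add
      intervalIntegrable_const (hi1.add hi2), intervalIntegral.integral_add hi1 hi2,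
      intervalIntegral.integral_const_mul]
    simp
  have hbound : ∀ δ : ℝ, 0 < δ → ‖c₀‖ ≤ δ := by
    intro δ hδ
    have h1 : Tendsto (fun R : ℝ => δ + δ⁻¹ * (R⁻¹ * ∫ t in Set.Ioo 0 R, ‖F t‖ ^ 2)) atTop
        (𝓝 δ) := by
      simpa using (hm.const_mul δ⁻¹).const_add δ
    refine le_of_tendsto_of_tendsto hlim.norm h1 ?_
    filter_upwards [eventually_gt_atTop 0] with R hR
    have e1 : R⁻¹ * ∫ t in Set.Ioo 0 R, ‖F t‖ ^ 2 = ∫ t in (0 : ℝ)..1, ‖F (R * t)‖ ^ 2 := by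
      rw [intervalIntegral.integral_comp_mul_left (fun t => ‖F t‖ ^ 2) hR.ne', mul_zero, mul_one,
        intervalIntegral.integral_of_le hR.le, integral_Ioc_eq_integral_Ioo, smul_eq_mul]
    have hsq : ContinuousOn (fun t => ‖F (R * t)‖ ^ 2) (Set.uIcc 0 1) :=
      ((hFc.comp (continuous_const.mul continuous_id).continuousOn (hmaps R hR.le)).norm).pow 2
    rw [e1]
    calc ‖∫ t in (0 : ℝ)..1, e₀ (R * t) * F (R * t)‖
        ≤ ∫ t in (0 : ℝ)..1, ‖e₀ (R * t) * F (R * t)‖ :=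
          intervalIntegral.norm_integral_le_integral_norm zero_le_one
      _ ≤ ∫ t in (0 : ℝ)..1, (δ + δ⁻¹ * ‖F (R * t)‖ ^ 2) := by
          refine intervalIntegral.integral_mono_on zero_le_one
            ((hgc hFc R hR.le).norm.intervalIntegrable)
            (continuousOn_const.add (continuousOn_const.mul hsq)).intervalIntegrable
            fun t _ => ?_
          rw [norm_mul, he₀, one_mul, ← sub_nonneg]
          have : 0 ≤ (δ - ‖F (R * t)‖) ^ 2 := sq_nonneg _
          have h2 : δ + δ⁻¹ * ‖F (R * t)‖ ^ 2 - ‖F (R * t)‖ =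
              δ⁻¹ * ((δ - ‖F (R * t)‖) ^ 2 + δ * ‖F (R * t)‖) := by field_simp; ring
          rw [h2]; positivity
      _ = δ + δ⁻¹ * ∫ t in (0 : ℝ)..1, ‖F (R * t)‖ ^ 2 := by
          have hi : IntervalIntegrable (fun t : ℝ => δ⁻¹ * ‖F (R * t)‖ ^ 2) volume 0 1 :=
            (continuousOn_const.mul hsq).intervalIntegrable
          rw [intervalIntegral.integral_add intervalIntegrable_const hi,
            intervalIntegral.integral_const_mul]
          simp
  exact norm_le_zero_iff.1 (le_of_forall_pos_le_add fun δ hδ => by simpa using hbound δ hδ)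

/-! ### Reading off amplitudes from the wave front set -/

theorem norm_sq_le_normSq2 (v : Fin 2 → ℂ) (k : Fin 2) : ‖v k‖ ^ 2 ≤ normSq2 v := by
  fin_cases k
  · exact le_add_of_nonneg_right (sq_nonneg ‖v 1‖)
  · exact le_add_of_nonneg_left (sq_nonneg ‖v 0‖)

theorem setIntegral_halfLine (f : ℝ → ℝ) (σ : ℤˣ) (R : ℝ) :
    ∫ s in Set.Ioo (-R) R ∩ {s : ℝ | 0 < (((σ : ℤ) : ℝ)) * s}, f s =
      ∫ t in Set.Ioo 0 R, f (((σ : ℤ) : ℝ) * t) := by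
  rcases Int.units_eq_one_or σ with rfl | rfl
  · have : Set.Ioo (-R) R ∩ {s : ℝ | 0 < (((1 : ℤˣ) : ℤ) : ℝ) * s} = Set.Ioo 0 R := by
      ext s; simp only [Set.mem_inter_iff, Set.mem_Ioo, Set.mem_ofPred_eq]
      push_cast
      constructor
      · rintro ⟨⟨_, h⟩, h'⟩; exact ⟨by linarith, h⟩
      · rintro ⟨h, h'⟩; exact ⟨⟨by linarith, h'⟩, by linarith⟩
    rw [this]; simp
  · have : Set.Ioo (-R) R ∩ {s : ℝ | 0 < (((-1 : ℤˣ) : ℤ) : ℝ) * s} = Neg.neg ⁻¹' Set.Ioo 0 R := by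
      ext s; simp only [Set.mem_inter_iff, Set.mem_Ioo, Set.mem_ofPred_eq, Set.mem_preimage]
      push_cast
      constructor
      · rintro ⟨⟨h, _⟩, h'⟩; exact ⟨by linarith, by linarith⟩
      · rintro ⟨h, h'⟩; exact ⟨⟨by linarith, by linarith⟩, by linarith⟩
    rw [this, ← (Measure.measurePreserving_neg (volume : Measure ℝ)).setIntegral_preimage_emb
      (MeasurableEquiv.neg ℝ).measurableEmbedding (fun t => f ((((-1 : ℤˣ) : ℤ) : ℝ) * t))]
    simp

/-- `localFourier` as a sum of oscillatory integrals. -/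
theorem localFourier_eq (φ : ℝ → ℝ) (A : ℝ → Matrix (Fin 2) (Fin 2) ℂ) (u : LatticeFun)
    (ψ : ℝ → ℂ) (s : ℝ) (k : Fin 2) :
    localFourier φ A u ψ s k = ((2 * Real.pi : ℝ) : ℂ)⁻¹ * ∑ l : Fin 2, ∑' y : ℤ,
      u y l * osc φ (fun ξ => ψ ξ * (A ξ k l * ((|deriv φ ξ| : ℝ) : ℂ))) y s := by
  have h2 : (((Real.sqrt (2 * Real.pi))⁻¹ : ℝ) : ℂ) * (((Real.sqrt (2 * Real.pi))⁻¹ : ℝ) : ℂ) =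
      ((2 * Real.pi : ℝ) : ℂ)⁻¹ := by
    rw [← Complex.ofReal_mul, ← mul_inv, Real.mul_self_sqrt (by positivity), Complex.ofReal_inv]
  simp only [localFourier, fourierPairing]
  rw [← Finset.mul_sum, ← mul_assoc, h2]
  congr 1
  refine Finset.sum_congr rfl fun l _ => tsum_congr fun y => ?_
  congr 1
  refine integral_congr_ae (Eventually.of_forall fun ξ => ?_)
  simp only [Complex.ofReal_add, mul_add, Complex.exp_add]
  ring

/-- Suppose that `u` is bounded and that on the half-line `στy < 0` it is, up to a summable
error, a superposition of plane waves with wave numbers `ξ₀` and `ζ`. If the direction `σ` over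
`ξ₀` is absent from `WF*(A û)`, where `A(ξ₀)` fixes the polarization `v` and `φ'` has the sign `τ`
at `ξ₀`, then the plane wave with wave number `ξ₀` has amplitude zero: it oscillates at the
covector `s` with `y + sφ'(ξ₀) = 0`. -/
theorem amplitude_eq_zero_of_notMemWF {φ : ℝ → ℝ} {A : ℝ → Matrix (Fin 2) (Fin 2) ℂ}
    {u : LatticeFun} {ξ₀ ζ : ℝ} {σ : ℤˣ} (hWF : NotMemWF φ A u ξ₀ σ) {v v' : Fin 2 → ℂ} {L L' : ℂ}
    (hv : (A ξ₀).mulVec v = v) (hv0 : v ≠ 0)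
    (hζ : Complex.exp (Complex.I * (ζ : ℂ)) ≠ Complex.exp (Complex.I * (ξ₀ : ℂ)))
    {B : ℝ} (hB : ∀ y l, ‖u y l‖ ≤ B) {τ : ℝ} (hτ : |τ| = 1) (hτφ : 0 < τ * deriv φ ξ₀)
    (hsum : ∀ l, Summable fun y : ℤ => if ((σ : ℤ) : ℝ) * τ * y < 0 then
      ‖u y l - (L * Complex.exp (Complex.I * ((y * ξ₀ : ℝ) : ℂ)) * v l +
        L' * Complex.exp (Complex.I * ((y * ζ : ℝ) : ℂ)) * v' l)‖ else 0) :
    L = 0 := by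
  obtain ⟨r, ψ, hr0, hr, hA, hφ, hφ', hψ, hψI, hψ1, hlim⟩ := hWF
  have hpi := Real.pi_pos
  set I := Set.Ioo (ξ₀ - r) (ξ₀ + r)
  have hI : IsOpen I := isOpen_Ioo
  have hξ₀ : ξ₀ ∈ I := ⟨by linarith, by linarith⟩
  have hdiff : ∀ ξ ∈ I, DifferentiableAt ℝ φ ξ := fun ξ hξ =>
    (hφ.differentiableOn (by simp)).differentiableAt (hI.mem_nhds hξ)
  have hσ : |(((σ : ℤ) : ℝ))| = 1 := by
    rcases Int.units_eq_one_or σ with rfl | rfl <;> simp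
  -- by Darboux's theorem `φ'` keeps its sign on `I`
  have hpos : ∀ ξ ∈ I, 0 < τ * deriv φ ξ := by
    have hτ0 : τ ≠ 0 := fun h => by simp [h] at hτ
    rcases hasDerivWithinAt_forall_lt_or_forall_gt_of_forall_ne (convex_Ioo _ _)
      (fun ξ hξ => ((hdiff ξ hξ).hasDerivAt.const_mul τ).hasDerivWithinAt)
      (fun ξ hξ => mul_ne_zero hτ0 (hφ' ξ hξ)) with h | h
    · exact absurd (h ξ₀ hξ₀) (not_lt.2 hτφ.le)
    · exact h
  have hinj : ∀ ξ ∈ I, ξ ≠ ξ₀ → φ ξ ≠ φ ξ₀ := by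
    have haux : ∀ a ∈ I, ∀ b ∈ I, a < b → φ a ≠ φ b := by
      intro a ha b hb hab heq
      have hsub : Set.Icc a b ⊆ I := Set.Icc_subset_Ioo ha.1 hb.2
      obtain ⟨x, hx, hx0⟩ := exists_deriv_eq_zero hab
        (fun z hz => (hdiff z (hsub hz)).continuousAt.continuousWithinAt) heq
      exact hφ' x (hsub (Set.Ioo_subset_Icc_self hx)) hx0
    intro ξ hξ hne
    rcases lt_or_gt_of_ne hne with h | h
    · exact haux ξ hξ ξ₀ hξ₀ h
    · exact (haux ξ₀ hξ₀ ξ hξ h).symm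
  -- replace `ζ` by its representative within half a period of `ξ₀`
  set η := toIcoMod Real.two_pi_pos (ξ₀ - Real.pi) ζ
  have hη : η ∈ Set.Icc (ξ₀ - Real.pi) (ξ₀ + Real.pi) := by
    have := toIcoMod_mem_Ico Real.two_pi_pos (ξ₀ - Real.pi) ζ
    exact ⟨this.1, by linarith [this.2]⟩
  have hηζ : ∀ y : ℤ, Complex.exp (Complex.I * ((y * ζ : ℝ) : ℂ)) =
      Complex.exp (Complex.I * ((y * η : ℝ) : ℂ)) := by
    intro y
    have h1 : ζ = η + toIcoDiv Real.two_pi_pos (ξ₀ - Real.pi) ζ • (2 * Real.pi) :=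
      (toIcoMod_add_toIcoDiv_zsmul Real.two_pi_pos (ξ₀ - Real.pi) ζ).symm
    rw [Complex.exp_eq_exp_iff_exists_int]
    refine ⟨y * toIcoDiv Real.two_pi_pos (ξ₀ - Real.pi) ζ, ?_⟩
    conv_lhs => rw [h1]
    simp only [zsmul_eq_mul]
    push_cast
    ring
  have hηξ₀ : η ≠ ξ₀ := by
    intro h
    have := hηζ 1
    rw [h] at this
    simp only [Int.cast_one, one_mul] at this
    exact hζ this
  set K : Fin 2 → Fin 2 → ℝ → ℂ := fun k l ξ => ψ ξ * (A ξ k l * ((|deriv φ ξ| : ℝ) : ℂ))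
  have hψa : IsAmplitude I ψ :=
    ⟨hψ, isCompact_Icc.of_isClosed_subset (isClosed_tsupport ψ)
      (hψI.trans Set.Ioo_subset_Icc_self), hψI⟩
  have hK : ∀ k l, IsAmplitude I (K k l) := by
    intro k l
    refine hψa.mul_right hI ((hA k l).mul ?_)
    have h1 : ContDiffOn ℝ ∞ (fun ξ => ((τ * deriv φ ξ : ℝ) : ℂ)) I :=
      Complex.ofRealCLM.contDiff.comp_contDiffOn
        (contDiffOn_const.mul (hφ.deriv_of_isOpen hI (by simp)))
    refine h1.congr fun ξ hξ => ?_
    rw [← abs_of_pos (hpos ξ hξ), abs_mul, hτ, one_mul]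
  set e : Fin 2 → ℤ → ℂ := fun l y => u y l -
    (L * Complex.exp (Complex.I * ((y * ξ₀ : ℝ) : ℂ)) * v l +
      L' * Complex.exp (Complex.I * ((y * ζ : ℝ) : ℂ)) * v' l)
  have hnorm : ∀ x : ℝ, ‖Complex.exp (Complex.I * (x : ℂ))‖ = 1 := fun x => by
    rw [mul_comm]; exact Complex.norm_exp_ofReal_mul_I x
  have he : ∀ l y, ‖e l y‖ ≤ B + (‖L‖ * ‖v l‖ + ‖L'‖ * ‖v' l‖) := by
    intro l y
    refine (norm_sub_le _ _).trans (add_le_add (hB y l) ((norm_add_le _ _).trans_eq ?_))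
    simp only [norm_mul, hnorm, mul_one]
  set E : Fin 2 → ℝ → ℂ := fun k t => ((2 * Real.pi : ℝ) : ℂ)⁻¹ * ∑ l : Fin 2, ∑' y : ℤ,
    e l y * osc φ (K k l) y (((σ : ℤ) : ℝ) * t)
  set c₀ : Fin 2 → ℂ := fun k => ∑ l : Fin 2, L * v l * K k l ξ₀
  set c₁ : Fin 2 → ℂ := fun k => ∑ l : Fin 2, L' * v' l * K k l η
  have hdecay := fun k l => tsum_osc_decay hI hφ hτ hσ hpos (hK k l) (he l) (hsum l)
  have hEc : ∀ k, ContinuousOn (E k) (Set.Ici 0) := fun k =>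
    continuousOn_const.mul (continuousOn_finsetSum _ fun l _ => (hdecay k l).1)
  have hEb : ∀ k, ∃ D, ∀ t ∈ Set.Ici (0 : ℝ), ‖E k t‖ ≤ D := by
    intro k
    choose D hD using fun l => (hdecay k l).2.1
    refine ⟨‖((2 * Real.pi : ℝ) : ℂ)⁻¹‖ * ∑ l, D l, fun t ht => ?_⟩
    rw [norm_mul]
    gcongr
    exact norm_sum_le_of_le _ fun l _ => hD l t ht
  have hE0 : ∀ k, Tendsto (E k) atTop (𝓝 0) := by
    intro k
    have := (tendsto_finsetSum Finset.univ fun l _ => (hdecay k l).2.2).const_mul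
      ((2 * Real.pi : ℝ) : ℂ)⁻¹
    simpa only [Finset.sum_const_zero, mul_zero] using this
  have hF : ∀ k t, localFourier φ A u ψ (((σ : ℤ) : ℝ) * t) k =
      c₀ k * Complex.exp (-Complex.I * ((t * (((σ : ℤ) : ℝ) * φ ξ₀) : ℝ) : ℂ)) +
      c₁ k * Complex.exp (-Complex.I * ((t * (((σ : ℤ) : ℝ) * φ η) : ℝ) : ℂ)) + E k t := by
    intro k t
    set s := ((σ : ℤ) : ℝ) * t
    have hs1 : t * (((σ : ℤ) : ℝ) * φ ξ₀) = s * φ ξ₀ := by simp only [s]; ring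
    have hs2 : t * (((σ : ℤ) : ℝ) * φ η) = s * φ η := by simp only [s]; ring
    rw [localFourier_eq, hs1, hs2]
    have hterm : ∀ l, ∑' y : ℤ, u y l * osc φ (K k l) y s =
        2 * Real.pi * (L * v l * K k l ξ₀ * Complex.exp (-Complex.I * ((s * φ ξ₀ : ℝ) : ℂ)) +
          L' * v' l * K k l η * Complex.exp (-Complex.I * ((s * φ η : ℝ) : ℂ))) +
        ∑' y : ℤ, e l y * osc φ (K k l) y s := by
      intro l
      have hs := summable_norm_osc hI hφ (hK k l) s
      have hbd : ∀ {f : ℤ → ℂ} {D : ℝ}, (∀ y, ‖f y‖ ≤ D) →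
          Summable fun y : ℤ => f y * osc φ (K k l) y s := fun {f D} hf =>
        Summable.of_norm_bounded (hs.mul_left D) fun y => by
          rw [norm_mul]; gcongr; exact hf y
      have hw : ∀ x : ℝ, Summable fun y : ℤ =>
          Complex.exp (Complex.I * ((y * x : ℝ) : ℂ)) * osc φ (K k l) y s :=
        fun x => hbd (D := 1) fun y => (hnorm _).le
      have h1 := tsum_planeWave_mul_osc hr hφ (hK k l) (ζ := ξ₀)
        ⟨by linarith, by linarith⟩ s
      have h2 := tsum_planeWave_mul_osc hr hφ (hK k l) hη s
      calc ∑' y : ℤ, u y l * osc φ (K k l) y s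
          = ∑' y : ℤ, (L * v l * (Complex.exp (Complex.I * ((y * ξ₀ : ℝ) : ℂ)) *
              osc φ (K k l) y s) + L' * v' l * (Complex.exp (Complex.I * ((y * η : ℝ) : ℂ)) *
              osc φ (K k l) y s) + e l y * osc φ (K k l) y s) := by
            refine tsum_congr fun y => ?_
            simp only [e, hηζ y]
            ring
        _ = _ := by
            rw [Summable.tsum_add (((hw ξ₀).mul_left _).add ((hw η).mul_left _)) (hbd (he l)),
              Summable.tsum_add ((hw ξ₀).mul_left _) ((hw η).mul_left _), tsum_mul_left,
              tsum_mul_left, h1, h2]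
            ring
    have hpi' : (Real.pi : ℂ) ≠ 0 := by exact_mod_cast hpi.ne'
    simp only [Fin.sum_univ_two, E, c₀, c₁] at hterm ⊢
    rw [hterm 0, hterm 1]
    push_cast
    field_simp
    ring
  have hFc : ∀ k, ContinuousOn (fun t => localFourier φ A u ψ (((σ : ℤ) : ℝ) * t) k)
      (Set.Ici 0) := by
    intro k
    simp only [hF]
    exact (Continuous.continuousOn (by fun_prop)).add (hEc k)
  have hFint : ∀ k R, IntegrableOn
      (fun t => ‖localFourier φ A u ψ (((σ : ℤ) : ℝ) * t) k‖ ^ 2) (Set.Ioo 0 R) := fun k R =>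
    ((((hFc k).norm.pow 2).mono Set.Icc_subset_Ici_self).integrableOn_Icc).mono_set
      Set.Ioo_subset_Icc_self
  have hc₀ : ∀ k, c₀ k = 0 := by
    intro k
    refine coeff_eq_zero_of_meanSq (fun t _ => hF k t) (hEc k) (hEb k) (hE0 k) ?_ ?_
    · by_cases h : η ∈ I
      · left
        have hσ0 : (((σ : ℤ) : ℝ)) ≠ 0 := fun h => by simp [h] at hσ
        exact fun h' => hinj η h hηξ₀ (mul_left_cancel₀ hσ0 h').symm
      · right
        simp only [c₁, (hK k _).eq_zero h, mul_zero, Finset.sum_const_zero]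
    · refine squeeze_zero' ?_ ?_ hlim
      · filter_upwards [eventually_ge_atTop 0] with R hR
        exact mul_nonneg (inv_nonneg.2 hR) (integral_nonneg fun _ => sq_nonneg _)
      · filter_upwards [eventually_ge_atTop 0] with R hR
        rw [setIntegral_halfLine]
        refine mul_le_mul_of_nonneg_left ?_ (inv_nonneg.2 hR)
        exact integral_mono (hFint k R) ((hFint 0 R).add (hFint 1 R))
          fun t => norm_sq_le_normSq2 _ k
  have hval : ∀ k, c₀ k = L * ((|deriv φ ξ₀| : ℝ) : ℂ) * v k := by
    intro k
    have h1 := congrFun hv k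
    simp only [Matrix.mulVec, dotProduct, Fin.sum_univ_two] at h1
    simp only [c₀, K, hψ1, Fin.sum_univ_two]
    linear_combination L * ((|deriv φ ξ₀| : ℝ) : ℂ) * h1
  obtain ⟨k, hk⟩ := Function.ne_iff.1 hv0
  have h1 := (hval k).symm.trans (hc₀ k)
  have h2 : ((|deriv φ ξ₀| : ℝ) : ℂ) ≠ 0 := by
    exact_mod_cast (abs_pos.2 (hφ' ξ₀ hξ₀)).ne'
  simpa [h2, show v k ≠ 0 from hk] using h1

/-! ### The conserved current -/

/-- The stationary equation `U u = μ u` in scattering form: the coin at `x` sends the amplitudes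
at `x` to the outgoing amplitudes at `x - 1` and `x + 1`. -/
def Scatters (C : ℤ → Matrix (Fin 2) (Fin 2) ℂ) (μ : ℂ) (u : LatticeFun) : Prop :=
  ∀ x, C x 0 0 * u x 0 + C x 0 1 * u x 1 = μ * u (x - 1) 0 ∧
    C x 1 0 * u x 0 + C x 1 1 * u x 1 = μ * u (x + 1) 1

theorem scatters_of_evolution_eq {C : ℤ → Matrix (Fin 2) (Fin 2) ℂ} {μ : ℂ} {u : LatticeFun}
    (h : ∀ x, evolution C u x = μ • u x) : Scatters C μ u := by
  intro x
  have h0 := congrFun (h (x - 1)) 0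
  have h1 := congrFun (h (x + 1)) 1
  simp [evolution, coinUpper, coinLower, dotProduct, Fin.sum_univ_two] at h0 h1
  exact ⟨h0, h1⟩

/-- The indefinite Hermitian form `x̄₀ y₀ - x̄₁ y₁` on `ℂ²`. -/
def hform (x y : Fin 2 → ℂ) : ℂ := conj (x 0) * y 0 - conj (x 1) * y 1

/-- The current of a pair of sequences through the bond between `x - 1` and `x`. -/
def current (f g : LatticeFun) (x : ℤ) : ℂ :=
  hform ![f (x - 1) 0, f x 1] ![g (x - 1) 0, g x 1]

theorem unitary_columns {A : Matrix (Fin 2) (Fin 2) ℂ} (hA : A ∈ Matrix.unitaryGroup (Fin 2) ℂ) :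
    conj (A 0 0) * A 0 0 + conj (A 1 0) * A 1 0 = 1 ∧
    conj (A 0 0) * A 0 1 + conj (A 1 0) * A 1 1 = 0 ∧
    conj (A 0 1) * A 0 0 + conj (A 1 1) * A 1 0 = 0 ∧
    conj (A 0 1) * A 0 1 + conj (A 1 1) * A 1 1 = 1 := by
  have h := Matrix.mem_unitaryGroup_iff'.1 hA
  have h' : ∀ i j, (star A * A) i j = (1 : Matrix (Fin 2) (Fin 2) ℂ) i j := fun i j => by rw [h]
  have h00 := h' 0 0
  have h01 := h' 0 1
  have h10 := h' 1 0
  have h11 := h' 1 1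
  simp [Matrix.mul_apply, Fin.sum_univ_two, Matrix.star_apply] at h00 h01 h10 h11
  exact ⟨h00, h01, h10, h11⟩

/-- Variation of the current along two solutions with different coins. -/
theorem current_succ_sub {C C' : ℤ → Matrix (Fin 2) (Fin 2) ℂ} {μ : ℂ} {f u : LatticeFun}
    (hC' : ∀ x, C' x ∈ Matrix.unitaryGroup (Fin 2) ℂ) (hμ : ‖μ‖ = 1)
    (hf : Scatters C' μ f) (hu : Scatters C μ u) (x : ℤ) :
    current f u (x + 1) - current f u x =
      -(conj (μ * f (x - 1) 0) *
          ((C x 0 0 - C' x 0 0) * u x 0 + (C x 0 1 - C' x 0 1) * u x 1) +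
        conj (μ * f (x + 1) 1) *
          ((C x 1 0 - C' x 1 0) * u x 0 + (C x 1 1 - C' x 1 1) * u x 1)) := by
  obtain ⟨h00, h01, h10, h11⟩ := unitary_columns (hC' x)
  obtain ⟨hf0, hf1⟩ := hf x
  obtain ⟨hu0, hu1⟩ := hu x
  have hμ' : conj μ * μ = 1 := by
    rw [← Complex.normSq_eq_conj_mul_self, Complex.normSq_eq_norm_sq, hμ]; simp
  have hf0' := congrArg conj hf0
  have hf1' := congrArg conj hf1
  simp only [map_mul, map_add] at hf0' hf1'
  simp only [current, hform, Matrix.cons_val_zero, Matrix.cons_val_one, add_sub_cancel_right,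
    map_mul]
  linear_combination
    (conj (f (x - 1) 0) * u (x - 1) 0 + conj (f (x + 1) 1) * u (x + 1) 1) * hμ'
    - conj (f x 0) * u x 0 * h00 - conj (f x 0) * u x 1 * h01
    - conj (f x 1) * u x 0 * h10 - conj (f x 1) * u x 1 * h11
    + conj μ * conj (f (x - 1) 0) * hu0 + conj μ * conj (f (x + 1) 1) * hu1
    + (C' x 0 0 * u x 0 + C' x 0 1 * u x 1) * hf0'
    + (C' x 1 0 * u x 0 + C' x 1 1 * u x 1) * hf1'

theorem current_eq_of_scatters {C : ℤ → Matrix (Fin 2) (Fin 2) ℂ} {μ : ℂ} {f u : LatticeFun}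
    (hC : ∀ x, C x ∈ Matrix.unitaryGroup (Fin 2) ℂ) (hμ : ‖μ‖ = 1)
    (hf : Scatters C μ f) (hu : Scatters C μ u) (x y : ℤ) : current f u x = current f u y := by
  have h : ∀ x, current f u (x + 1) = current f u x := fun x => by
    have := current_succ_sub hC hμ hf hu x
    simpa [sub_eq_zero] using this
  have h0 : ∀ x, current f u x = current f u 0 := by
    intro x
    induction x using Int.induction_on with
    | zero => rfl
    | succ n ih => rw [h, ih]
    | pred n ih => rw [← ih, ← h (-(n : ℤ) - 1)]; simp
  rw [h0 x, h0 y]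

theorem conj_hform (a b : Fin 2 → ℂ) : conj (hform a b) = hform b a := by
  simp only [hform, map_sub, map_mul, Complex.conj_conj]; ring

/-- Two non-isotropic vectors that are orthogonal for the current form are a basis. -/
theorem eq_hform_expansion {a b : Fin 2 → ℂ} (hab : hform a b = 0) (ha : hform a a ≠ 0)
    (hb : hform b b ≠ 0) (w : Fin 2 → ℂ) (l : Fin 2) :
    w l = hform a w / hform a a * a l + hform b w / hform b b * b l := by
  have hba : hform b a = 0 := by rw [← conj_hform, hab, map_zero]
  set A := hform a w / hform a a
  set B := hform b w / hform b b
  have hA : A * hform a a = hform a w := div_mul_cancel₀ _ ha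
  have hB : B * hform b b = hform b w := div_mul_cancel₀ _ hb
  have h1 : conj (a 0) * (w 0 - (A * a 0 + B * b 0)) =
      conj (a 1) * (w 1 - (A * a 1 + B * b 1)) := by
    simp only [hform] at *
    linear_combination -hA - B * hab
  have h2 : conj (b 0) * (w 0 - (A * a 0 + B * b 0)) =
      conj (b 1) * (w 1 - (A * a 1 + B * b 1)) := by
    simp only [hform] at *
    linear_combination -hB - A * hba
  set Δ := conj (a 0) * conj (b 1) - conj (a 1) * conj (b 0)
  have hΔ : Δ ≠ 0 := by
    intro h
    have h3 : Δ * (a 0 * b 1 - a 1 * b 0) = hform a b * hform b a - hform a a * hform b b := by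
      simp only [Δ, hform]; ring
    rw [h, hab, zero_mul, zero_mul, zero_sub, eq_comm, neg_eq_zero] at h3
    exact mul_ne_zero ha hb h3
  have h3 : Δ * (w 0 - (A * a 0 + B * b 0)) = 0 := by
    simp only [Δ]; linear_combination conj (b 1) * h1 - conj (a 1) * h2
  have h4 : Δ * (w 1 - (A * a 1 + B * b 1)) = 0 := by
    simp only [Δ]; linear_combination conj (b 0) * h1 - conj (a 0) * h2
  fin_cases l
  · exact sub_eq_zero.1 ((mul_eq_zero.1 h3).resolve_left hΔ)
  · exact sub_eq_zero.1 ((mul_eq_zero.1 h4).resolve_left hΔ)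

theorem hform_self_expansion {a b : Fin 2 → ℂ} (hab : hform a b = 0) (ha : hform a a ≠ 0)
    (hb : hform b b ≠ 0) (w : Fin 2 → ℂ) :
    hform w w = conj (hform a w / hform a a) * (hform a w / hform a a) * hform a a +
      conj (hform b w / hform b b) * (hform b w / hform b b) * hform b b := by
  have hba : hform b a = 0 := by rw [← conj_hform, hab, map_zero]
  have h0 := eq_hform_expansion hab ha hb w 0
  have h1 := eq_hform_expansion hab ha hb w 1
  set A := hform a w / hform a a
  set B := hform b w / hform b b
  have e : hform w w = conj (w 0) * w 0 - conj (w 1) * w 1 := rfl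
  rw [e, h0, h1]
  simp only [hform, map_add, map_mul] at *
  linear_combination (conj A * B) * hab + (conj B * A) * hba

/-! ### Plane waves -/

/-- The plane wave `e^{ixξ} v`. -/
noncomputable def planeWave (ξ : ℝ) (v : Fin 2 → ℂ) : LatticeFun := fun x l =>
  Complex.exp (Complex.I * ((x * ξ : ℝ) : ℂ)) * v l

theorem norm_planeWave (ξ : ℝ) (v : Fin 2 → ℂ) (x : ℤ) (l : Fin 2) :
    ‖planeWave ξ v x l‖ = ‖v l‖ := by
  rw [planeWave, norm_mul, mul_comm Complex.I, Complex.norm_exp_ofReal_mul_I, one_mul]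

theorem planeWave_add (ξ : ℝ) (v : Fin 2 → ℂ) (x y : ℤ) (l : Fin 2) :
    planeWave ξ v (x + y) l = Complex.exp (Complex.I * ((y * ξ : ℝ) : ℂ)) * planeWave ξ v x l := by
  simp only [planeWave]
  rw [← mul_assoc, ← Complex.exp_add]
  congr 2
  push_cast
  ring

theorem conj_exp_mul_self (t : ℝ) :
    conj (Complex.exp (Complex.I * (t : ℂ))) * Complex.exp (Complex.I * (t : ℂ)) = 1 := by
  rw [← Complex.normSq_eq_conj_mul_self, Complex.normSq_eq_norm_sq, mul_comm,
    Complex.norm_exp_ofReal_mul_I]; simp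

theorem current_planeWave_self (ξ : ℝ) (v : Fin 2 → ℂ) (x : ℤ) :
    current (planeWave ξ v) (planeWave ξ v) x = hform v v := by
  have h1 := conj_exp_mul_self (((x - 1 : ℤ) : ℝ) * ξ)
  have h2 := conj_exp_mul_self ((x : ℝ) * ξ)
  simp only [current, hform, planeWave, Matrix.cons_val_zero, Matrix.cons_val_one, map_mul]
  linear_combination conj (v 0) * v 0 * h1 - conj (v 1) * v 1 * h2

theorem LimitCoin.matrix_mem_unitaryGroup (c : LimitCoin) :
    c.matrix ∈ Matrix.unitaryGroup (Fin 2) ℂ := by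
  rw [Matrix.mem_unitaryGroup_iff']
  have hγ := conj_exp_mul_self (c.γ / 2)
  have hα := conj_exp_mul_self (c.α - c.γ / 2)
  have hβ := conj_exp_mul_self (c.β - c.γ / 2)
  have hpq : (c.p : ℂ) ^ 2 + (c.q : ℂ) ^ 2 = 1 := by exact_mod_cast c.sq_add_sq
  have hneg : ∀ t : ℝ, Complex.exp (-Complex.I * (t : ℂ)) =
      conj (Complex.exp (Complex.I * (t : ℂ))) := by
    intro t; rw [← Complex.exp_conj]; simp
  have hM : c.matrix = Complex.exp (Complex.I * ((c.γ / 2 : ℝ) : ℂ)) •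
      !![(c.p : ℂ) * Complex.exp (Complex.I * ((c.α - c.γ / 2 : ℝ) : ℂ)),
        (c.q : ℂ) * Complex.exp (Complex.I * ((c.β - c.γ / 2 : ℝ) : ℂ));
        -(c.q : ℂ) * conj (Complex.exp (Complex.I * ((c.β - c.γ / 2 : ℝ) : ℂ))),
        (c.p : ℂ) * conj (Complex.exp (Complex.I * ((c.α - c.γ / 2 : ℝ) : ℂ)))] := by
    rw [LimitCoin.matrix, hneg, hneg]
  rw [hM]
  generalize Complex.exp (Complex.I * ((c.γ / 2 : ℝ) : ℂ)) = g at *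
  generalize Complex.exp (Complex.I * ((c.α - c.γ / 2 : ℝ) : ℂ)) = a at *
  generalize Complex.exp (Complex.I * ((c.β - c.γ / 2 : ℝ) : ℂ)) = b at *
  ext i j
  fin_cases i <;> fin_cases j <;>
    simp [Matrix.mul_apply, Fin.sum_univ_two, Matrix.star_apply]
  · linear_combination (conj a * a * c.p ^ 2 + conj b * b * c.q ^ 2) * hγ + c.p ^ 2 * hα +
      c.q ^ 2 * hβ + hpq
  · ring
  · ring
  · linear_combination (conj a * a * c.p ^ 2 + conj b * b * c.q ^ 2) * hγ + c.p ^ 2 * hα +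
      c.q ^ 2 * hβ + hpq

theorem scatters_planeWave (c : LimitCoin) {ξ : ℝ} {μ : ℂ} {v : Fin 2 → ℂ}
    (hv : (c.symbol ξ).mulVec v = μ • v) :
    Scatters (fun _ => c.matrix) μ (planeWave ξ v) := by
  intro x
  have h0 := congrFun hv 0
  have h1 := congrFun hv 1
  simp only [LimitCoin.symbol, Matrix.mulVec, dotProduct, Fin.sum_univ_two, Matrix.diagonal_mul,
    Matrix.cons_val_zero, Matrix.cons_val_one, Pi.smul_apply, smul_eq_mul] at h0 h1
  have e0 := planeWave_add ξ v (x - 1) 1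
  have e1 := planeWave_add ξ v x 1
  have e2 : Complex.exp (Complex.I * (ξ : ℂ)) * Complex.exp (-Complex.I * (ξ : ℂ)) = 1 := by
    rw [← Complex.exp_add]; simp
  have e3 : Complex.exp (Complex.I * (ξ : ℂ)) ≠ 0 := Complex.exp_ne_zero _
  have e4 : Complex.exp (-Complex.I * (ξ : ℂ)) ≠ 0 := Complex.exp_ne_zero _
  simp only [sub_add_cancel, Int.cast_one, one_mul] at e0 e1
  have e5 := e0 0
  have e6 := e1 1
  constructor
  · refine mul_left_cancel₀ e3 ?_
    simp only [planeWave] at e5 ⊢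
    linear_combination Complex.exp (Complex.I * ((x * ξ : ℝ) : ℂ)) * h0 + μ * e5
  · refine mul_left_cancel₀ e4 ?_
    simp only [planeWave] at e6 ⊢
    linear_combination Complex.exp (Complex.I * ((x * ξ : ℝ) : ℂ)) * h1 -
      Complex.exp (-Complex.I * (ξ : ℂ)) * μ * e6 -
      Complex.exp (Complex.I * ((x * ξ : ℝ) : ℂ)) * v 1 * μ * e2

/-- Plane waves of equal quasi-energy and different wave numbers carry no cross current. -/
theorem current_planeWave_eq_zero (c : LimitCoin) {ξ ζ : ℝ} {μ : ℂ} (hμ : ‖μ‖ = 1)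
    {v w : Fin 2 → ℂ} (hv : (c.symbol ξ).mulVec v = μ • v) (hw : (c.symbol ζ).mulVec w = μ • w)
    (hne : Complex.exp (Complex.I * (ζ : ℂ)) ≠ Complex.exp (Complex.I * (ξ : ℂ))) (x : ℤ) :
    current (planeWave ξ v) (planeWave ζ w) x = 0 := by
  have h1 := current_eq_of_scatters (fun _ => c.matrix_mem_unitaryGroup) hμ
    (scatters_planeWave c hv) (scatters_planeWave c hw) (x + 1) x
  have h2 : current (planeWave ξ v) (planeWave ζ w) (x + 1) =
      conj (Complex.exp (Complex.I * (ξ : ℂ))) * Complex.exp (Complex.I * (ζ : ℂ)) *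
        current (planeWave ξ v) (planeWave ζ w) x := by
    have e0 := fun ξ v => planeWave_add ξ v (x - 1) 1 0
    have e1 := fun ξ v => planeWave_add ξ v x 1 1
    simp only [Int.cast_one, one_mul, sub_add_cancel] at e0 e1
    simp only [current, hform, Matrix.cons_val_zero, Matrix.cons_val_one, add_sub_cancel_right,
      e0 ξ v, e0 ζ w, e1 ξ v, e1 ζ w, map_mul]
    ring
  rw [h2] at h1
  by_contra h0
  have h3 := mul_right_cancel₀ h0 (h1.trans (one_mul _).symm)
  apply hne
  linear_combination Complex.exp (Complex.I * (ξ : ℂ)) * h3 -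
    Complex.exp (Complex.I * (ζ : ℂ)) * conj_exp_mul_self ξ

/-! ### Sequences with exponentially small increments -/

section Increments

variable {V : Type*} [NormedAddCommGroup V]

/-- One step along the half-line `ςℕ` is a step of `ℤ` at least as far out. -/
theorem norm_step_le {a : ℤ → V} {g : ℤ → ℤ → ℝ} {K ρ : ℝ} (hK : 0 ≤ K) (hρ : 0 < ρ) (hρ1 : ρ < 1)
    (hg : ∀ x y, g x y = g y x) (hg0 : ∀ x y, 0 ≤ g x y)
    (h : ∀ x, ‖a (x + 1) - a x‖ ≤ K * ρ ^ x.natAbs * g x (x + 1)) (ς : ℤˣ) (n : ℕ) :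
    ‖a (ς * (n + 1 : ℕ)) - a (ς * n)‖ ≤ K * ρ ^ n * g (ς * n) (ς * (n + 1 : ℕ)) := by
  rcases Int.units_eq_one_or ς with rfl | rfl
  · simpa using h n
  · have h1 := h (-(n + 1 : ℕ))
    have e : (-(n + 1 : ℕ) + 1 : ℤ) = -n := by push_cast; ring
    rw [e, Int.natAbs_neg, Int.natAbs_natCast] at h1
    simp only [Units.val_neg, Units.val_one, neg_mul, one_mul]
    rw [norm_sub_rev, hg]
    refine h1.trans ?_
    have := hg0 (-(n + 1 : ℕ)) (-n)
    have := pow_le_pow_of_le_one hρ.le hρ1.le (Nat.le_succ n)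
    gcongr

theorem exists_limit_of_increments [CompleteSpace V] {a : ℤ → V} {K ρ : ℝ} (hK : 0 ≤ K)
    (hρ : 0 < ρ) (hρ1 : ρ < 1)
    (h : ∀ x, ‖a (x + 1) - a x‖ ≤ K * ρ ^ x.natAbs) (ς : ℤˣ) :
    ∃ L, ∀ x : ℤ, 0 ≤ ς * x → ‖a x - L‖ ≤ K / (1 - ρ) * ρ ^ x.natAbs := by
  have hstep : ∀ n : ℕ, dist (a (ς * n)) (a (ς * (n + 1 : ℕ))) ≤ K * ρ ^ n := fun n => by
    rw [dist_comm, dist_eq_norm]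
    simpa using norm_step_le (g := fun _ _ => 1) hK hρ hρ1 (fun _ _ => rfl)
      (fun _ _ => zero_le_one) (by simpa using h) ς n
  obtain ⟨L, hL⟩ := cauchySeq_tendsto_of_complete
    (cauchySeq_of_le_geometric (f := fun n : ℕ => a (ς * n)) ρ K hρ1 hstep)
  refine ⟨L, fun x hx => ?_⟩
  have h1 := dist_le_of_le_geometric_of_tendsto (f := fun n : ℕ => a (ς * n)) ρ K hρ1 hstep hL
    x.natAbs
  have e : (ς : ℤ) * x.natAbs = x := by
    rcases Int.units_eq_one_or ς with rfl | rfl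
    · simp only [Units.val_one, one_mul] at hx ⊢; omega
    · simp only [Units.val_neg, Units.val_one, neg_mul, one_mul] at hx ⊢; omega
  rw [e, dist_eq_norm] at h1
  refine h1.trans_eq (by ring)

/-- If the increments are small relative to the sequence itself, the sequence cannot decay to
zero without vanishing somewhere. -/
theorem exists_eq_zero_of_increments {a : ℤ → V} {K ρ : ℝ} (hK : 0 ≤ K)
    (hρ : 0 < ρ) (hρ1 : ρ < 1)
    (h : ∀ x, ‖a (x + 1) - a x‖ ≤ K * ρ ^ x.natAbs * (‖a x‖ + ‖a (x + 1)‖)) (ς : ℤˣ)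
    (h0 : Tendsto (fun n : ℕ => a (ς * n)) atTop (𝓝 0)) : ∃ x, a x = 0 := by
  set e : ℕ → V := fun n => a (ς * n)
  have hstep : ∀ n : ℕ, ‖e (n + 1) - e n‖ ≤ K * ρ ^ n * (‖e n‖ + ‖e (n + 1)‖) :=
    norm_step_le (g := fun x y => ‖a x‖ + ‖a y‖) hK hρ hρ1 (fun _ _ => add_comm _ _)
      (fun _ _ => by positivity) h ς
  have hρ' : 0 < 1 - ρ := by linarith
  have hsmall : Tendsto (fun n : ℕ => 2 * K / (1 - ρ) * ρ ^ n) atTop (𝓝 0) := by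
    simpa using (tendsto_pow_atTop_nhds_zero_of_lt_one hρ.le hρ1).const_mul (2 * K / (1 - ρ))
  obtain ⟨n₀, hn₀⟩ := (hsmall.eventually (gt_mem_nhds one_half_pos)).exists
  -- any bound on the tail beyond `n₀` improves by a factor of two
  have hhalf : ∀ B, 0 ≤ B → (∀ m, ‖e (n₀ + m)‖ ≤ B) → ∀ m, ‖e (n₀ + m)‖ ≤ B / 2 := by
    intro B hB0 hB m
    have h1 : ∀ m, dist (e (n₀ + m)) (e (n₀ + (m + 1))) ≤ 2 * K * B * ρ ^ n₀ * ρ ^ m := by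
      intro m
      rw [dist_comm, dist_eq_norm]
      calc _ ≤ K * ρ ^ (n₀ + m) * (‖e (n₀ + m)‖ + ‖e (n₀ + (m + 1))‖) := hstep (n₀ + m)
        _ ≤ K * ρ ^ (n₀ + m) * (B + B) := by gcongr <;> exact hB _
        _ = _ := by rw [pow_add]; ring
    have h2 : Tendsto (fun m => e (n₀ + m)) atTop (𝓝 0) := by
      have := (tendsto_add_atTop_iff_nat (f := e) n₀).2 h0
      simpa only [add_comm] using this
    have h3 := dist_le_of_le_geometric_of_tendsto (f := fun m => e (n₀ + m)) ρ _ hρ1 h1 h2 m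
    rw [dist_zero_right] at h3
    have h4 : ρ ^ m ≤ 1 := pow_le_one₀ hρ.le hρ1.le
    calc ‖e (n₀ + m)‖ ≤ 2 * K * B * ρ ^ n₀ * ρ ^ m / (1 - ρ) := h3
      _ = (2 * K / (1 - ρ) * ρ ^ n₀) * B * ρ ^ m := by ring
      _ ≤ 1 / 2 * B * 1 := by gcongr
      _ = B / 2 := by ring
  obtain ⟨B, hB⟩ := h0.norm.bddAbove_range
  have hB' : ∀ m, ‖e (n₀ + m)‖ ≤ B := fun m => hB ⟨n₀ + m, rfl⟩
  have hB0 : 0 ≤ B := (norm_nonneg _).trans (hB' 0)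
  have hiter : ∀ j : ℕ, ∀ m, ‖e (n₀ + m)‖ ≤ B * (1 / 2) ^ j := by
    intro j
    induction j with
    | zero => simpa using hB'
    | succ j ih =>
      intro m
      refine (hhalf _ (by positivity) ih m).trans_eq ?_
      rw [pow_succ]; ring
  have hlim : Tendsto (fun j : ℕ => B * (1 / 2 : ℝ) ^ j) atTop (𝓝 0) := by
    simpa using (tendsto_pow_atTop_nhds_zero_of_lt_one (r := (1 / 2 : ℝ)) (by norm_num)
      (by norm_num)).const_mul B
  exact ⟨ς * (n₀ + 0 : ℕ), norm_le_zero_iff.1 (ge_of_tendsto' hlim fun j => hiter j 0)⟩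

end Increments

/-! ### Asymptotics of stationary states -/

/-- The coefficient, at the bond between `x - 1` and `x`, of the plane wave `e^{ixξ} v` in `u`. -/
noncomputable def amplitude (ξ : ℝ) (v : Fin 2 → ℂ) (u : LatticeFun) (x : ℤ) : ℂ :=
  current (planeWave ξ v) u x / hform v v

section Amplitude

variable {ξ ζ : ℝ} {v w : Fin 2 → ℂ}

theorem amplitude_expansion
    (horth : ∀ x, current (planeWave ξ v) (planeWave ζ w) x = 0)
    (hv : hform v v ≠ 0) (hw : hform w w ≠ 0) (u : LatticeFun) (x : ℤ) :
    u (x - 1) 0 = amplitude ξ v u x * planeWave ξ v (x - 1) 0 +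
        amplitude ζ w u x * planeWave ζ w (x - 1) 0 ∧
    u x 1 = amplitude ξ v u x * planeWave ξ v x 1 + amplitude ζ w u x * planeWave ζ w x 1 ∧
    current u u x = ((‖amplitude ξ v u x‖ ^ 2 : ℝ) : ℂ) * hform v v +
        ((‖amplitude ζ w u x‖ ^ 2 : ℝ) : ℂ) * hform w w := by
  have e1 := current_planeWave_self ξ v x
  have e2 := current_planeWave_self ζ w x
  have e3 := horth x
  simp only [current] at e1 e2 e3
  have h1 : hform ![planeWave ξ v (x - 1) 0, planeWave ξ v x 1]
    ![planeWave ξ v (x - 1) 0, planeWave ξ v x 1] ≠ 0 := by rwa [e1]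
  have h2 : hform ![planeWave ζ w (x - 1) 0, planeWave ζ w x 1]
    ![planeWave ζ w (x - 1) 0, planeWave ζ w x 1] ≠ 0 := by rwa [e2]
  have hexp := eq_hform_expansion e3 h1 h2 ![u (x - 1) 0, u x 1]
  have hself := hform_self_expansion e3 h1 h2 ![u (x - 1) 0, u x 1]
  rw [e1, e2] at hself
  simp only [e1, e2] at hexp
  refine ⟨hexp 0, hexp 1, hself.trans ?_⟩
  simp only [amplitude, current, ← Complex.normSq_eq_conj_mul_self, Complex.normSq_eq_norm_sq]

theorem norm_amplitude_succ_sub_le (c : LimitCoin) {C : ℤ → Matrix (Fin 2) (Fin 2) ℂ} {μ : ℂ}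
    (hμ : ‖μ‖ = 1) (hv : (c.symbol ξ).mulVec v = μ • v) {u : LatticeFun} (hu : Scatters C μ u)
    {x : ℤ} {δ : ℝ} (hδ : ∀ j k, ‖C x j k - c.matrix j k‖ ≤ δ) :
    ‖amplitude ξ v u (x + 1) - amplitude ξ v u x‖ ≤
      (‖v 0‖ + ‖v 1‖) / ‖hform v v‖ * (δ * (‖u x 0‖ + ‖u x 1‖)) := by
  rw [amplitude, amplitude, ← sub_div, norm_div,
    current_succ_sub (fun _ => c.matrix_mem_unitaryGroup) hμ (scatters_planeWave c hv) hu,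
    norm_neg, div_mul_eq_mul_div]
  gcongr
  have hrow : ∀ j, ‖(C x j 0 - c.matrix j 0) * u x 0 + (C x j 1 - c.matrix j 1) * u x 1‖ ≤
      δ * (‖u x 0‖ + ‖u x 1‖) := by
    intro j
    refine (norm_add_le _ _).trans ?_
    rw [norm_mul, norm_mul, mul_add]
    gcongr <;> exact hδ _ _
  refine (norm_add_le _ _).trans ?_
  rw [norm_mul, norm_mul, RCLike.norm_conj, RCLike.norm_conj, norm_mul, norm_mul, hμ,
    norm_planeWave, norm_planeWave, one_mul, one_mul, add_mul]
  gcongr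
  · exact hrow 0
  · exact hrow 1

end Amplitude

/-- The perturbation of the coin, and its product with a function in `𝓑*`, decay
exponentially. -/
theorem exists_exp_decay {c : LimitCoin} {C : ℤ → Matrix (Fin 2) (Fin 2) ℂ} (hC : ExpClose c C)
    {u : LatticeFun} (hu : MemBStar u) :
    ∃ M K ρ : ℝ, 0 ≤ M ∧ 0 ≤ K ∧ 0 < ρ ∧ ρ < 1 ∧ (∀ x j k,
      ‖C x j k - c.matrix j k‖ ≤ M * ρ ^ x.natAbs) ∧
      ∀ x, M * ρ ^ x.natAbs * (‖u x 0‖ + ‖u x 1‖) ≤ K * (ρ ^ (1 / 2 : ℝ)) ^ x.natAbs := by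
  obtain ⟨ε, M, hε, hM, hCM⟩ := hC
  obtain ⟨B, hB⟩ := hu
  have habs : ∀ x : ℤ, (x.natAbs : ℝ) = |(x : ℝ)| := fun x => by
    rw [Nat.cast_natAbs, Int.cast_abs]
  have hpow : ∀ (t : ℝ) (n : ℕ), Real.exp (-t) ^ n = Real.exp (-(t * n)) := fun t n => by
    rw [← Real.exp_nat_mul]; congr 1; ring
  have hB0 : 0 ≤ B := (by
    have h1 := hB 2 one_lt_two
    refine le_trans (mul_nonneg (by norm_num) (Finset.sum_nonneg fun x _ => ?_)) h1
    exact add_nonneg (sq_nonneg _) (sq_nonneg _))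
  have hgrow : ∀ x l, ‖u x l‖ ≤ (1 + 2 * B) * (1 + (x.natAbs : ℝ)) := by
    intro x l
    have hR : (1 : ℝ) < x.natAbs + 2 := by
      have : (0 : ℝ) ≤ x.natAbs := Nat.cast_nonneg _
      linarith
    have h1 := hB (x.natAbs + 2) hR
    have hceil : ⌈((x.natAbs : ℝ) + 2)⌉ = (x.natAbs : ℤ) + 2 := by
      have : ((x.natAbs : ℝ) + 2) = (((x.natAbs : ℤ) + 2 : ℤ) : ℝ) := by
        rw [Int.cast_add, Int.cast_natCast, Int.cast_ofNat]
      rw [this, Int.ceil_intCast]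
    rw [hceil, inv_mul_le_iff₀ (by linarith)] at h1
    have h2 : normSq2 (u x) ≤ (x.natAbs + 2) * B := by
      refine le_trans ?_ h1
      refine Finset.single_le_sum (f := fun x => normSq2 (u x))
        (fun y _ => add_nonneg (sq_nonneg _) (sq_nonneg _)) ?_
      rw [Finset.mem_Ioo]; omega
    have h3 := (norm_sq_le_normSq2 (u x) l).trans h2
    have hn : (0 : ℝ) ≤ x.natAbs := Nat.cast_nonneg _
    nlinarith [sq_nonneg (‖u x l‖ - 1), mul_nonneg hn hB0]
  refine ⟨M, M * (2 * (1 + 2 * B) * (1 + 2 / ε)), Real.exp (-ε), hM.le, by positivity,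
    Real.exp_pos _, by simpa using hε, fun x j k => (hCM x j k).trans ?_, fun x => ?_⟩
  · rw [hpow, habs]
    have h1 : |(x : ℝ)| ≤ Real.sqrt (1 + (x : ℝ) ^ 2) := Real.abs_le_sqrt (by linarith)
    gcongr
    nlinarith
  · set n := x.natAbs
    have hn : (0 : ℝ) ≤ n := Nat.cast_nonneg _
    rw [← Real.exp_mul, show -ε * (1 / 2) = -(ε / 2) by ring, hpow, hpow]
    have h1 := hgrow x 0
    have h2 := hgrow x 1
    -- the linear growth of `u` costs half of the exponential rate
    have h3 : (1 : ℝ) + n ≤ (1 + 2 / ε) * Real.exp (ε / 2 * n) := by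
      have h4 := Real.add_one_le_exp (ε / 2 * n)
      have h5 : (1 : ℝ) ≤ Real.exp (ε / 2 * n) := Real.one_le_exp (by positivity)
      have h6 : (n : ℝ) ≤ 2 / ε * Real.exp (ε / 2 * n) := by
        rw [div_mul_eq_mul_div, le_div_iff₀ hε]; linarith
      linarith
    calc M * Real.exp (-(ε * n)) * (‖u x 0‖ + ‖u x 1‖)
        ≤ M * Real.exp (-(ε * n)) * (2 * (1 + 2 * B) * ((1 + 2 / ε) * Real.exp (ε / 2 * n))) := by
          gcongr
          have : 0 ≤ 2 * B := by linarith
          nlinarith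
      _ = M * (2 * (1 + 2 * B) * (1 + 2 / ε)) * (Real.exp (-(ε * n)) * Real.exp (ε / 2 * n)) := by
          ring
      _ = _ := by rw [← Real.exp_add]; congr 2; ring

/-- A solution that vanishes on one bond vanishes identically; this is where `a(x) ≠ 0` enters. -/
theorem eq_zero_of_eq_zero_at_bond {C : ℤ → Matrix (Fin 2) (Fin 2) ℂ}
    (hC : ∀ x, C x ∈ Matrix.unitaryGroup (Fin 2) ℂ) (ha : ∀ x, C x 0 0 ≠ 0) {μ : ℂ} (hμ : μ ≠ 0)
    {u : LatticeFun} (hu : Scatters C μ u) {x₀ : ℤ} (h0 : u (x₀ - 1) 0 = 0) (h1 : u x₀ 1 = 0) :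
    u = 0 := by
  have hd : ∀ x, C x 1 1 ≠ 0 := by
    intro x hd
    obtain ⟨-, h01, -, h11⟩ := unitary_columns (hC x)
    have : C x 0 1 = 0 := by simpa [hd, ha x] using h01
    simp [this, hd] at h11
  have hup : ∀ x, u (x - 1) 0 = 0 ∧ u x 1 = 0 → u (x + 1 - 1) 0 = 0 ∧ u (x + 1) 1 = 0 := by
    rintro x ⟨h, h'⟩
    obtain ⟨e0, e1⟩ := hu x
    have h2 : u x 0 = 0 := by simpa [h, h', ha x] using e0
    refine ⟨by simpa using h2, ?_⟩
    simpa [h2, h', hμ, eq_comm] using e1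
  have hdown : ∀ x, u (x + 1 - 1) 0 = 0 ∧ u (x + 1) 1 = 0 → u (x - 1) 0 = 0 ∧ u x 1 = 0 := by
    rintro x ⟨h, h'⟩
    rw [add_sub_cancel_right] at h
    obtain ⟨e0, e1⟩ := hu x
    have h2 : u x 1 = 0 := by simpa [h, h', hd x] using e1
    refine ⟨?_, h2⟩
    simpa [h2, h, hμ, eq_comm] using e0
  have hall : ∀ x, u (x - 1) 0 = 0 ∧ u x 1 = 0 := by
    have : ∀ n : ℤ, u (x₀ + n - 1) 0 = 0 ∧ u (x₀ + n) 1 = 0 := by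
      intro n
      induction n using Int.induction_on with
      | zero => simpa using ⟨h0, h1⟩
      | succ n ih => rw [← add_assoc]; exact hup _ ih
      | pred n ih =>
        refine hdown _ ?_
        rwa [show x₀ + (-(n : ℤ) - 1) + 1 = x₀ + -(n : ℤ) by ring]
    intro x
    simpa using this (x - x₀)
  funext x l
  fin_cases l
  · simpa using (hall (x + 1)).1
  · exact (hall x).2

/-! ### Stationary states between plane waves -/

/-- Two plane waves of quasi-energy `μ` with different wave numbers `ξ`, `ζ` and non-zero currents:
a basis of the stationary states of the position-independent walk. -/
structure WavePair (c : LimitCoin) (μ : ℂ) (ξ ζ : ℝ) (v w : Fin 2 → ℂ) : Prop where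
  norm_eq_one : ‖μ‖ = 1
  left_eq : (c.symbol ξ).mulVec v = μ • v
  right_eq : (c.symbol ζ).mulVec w = μ • w
  exp_ne : Complex.exp (Complex.I * (ζ : ℂ)) ≠ Complex.exp (Complex.I * (ξ : ℂ))
  left_ne : hform v v ≠ 0
  right_ne : hform w w ≠ 0

namespace WavePair

variable {c : LimitCoin} {C : ℤ → Matrix (Fin 2) (Fin 2) ℂ} {μ : ℂ} {ξ ζ : ℝ} {v w : Fin 2 → ℂ}
  {u : LatticeFun}

theorem expansion (h : WavePair c μ ξ ζ v w) (u : LatticeFun) (x : ℤ) :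
    u (x - 1) 0 = amplitude ξ v u x * planeWave ξ v (x - 1) 0 +
        amplitude ζ w u x * planeWave ζ w (x - 1) 0 ∧
    u x 1 = amplitude ξ v u x * planeWave ξ v x 1 + amplitude ζ w u x * planeWave ζ w x 1 ∧
    current u u x = ((‖amplitude ξ v u x‖ ^ 2 : ℝ) : ℂ) * hform v v +
        ((‖amplitude ζ w u x‖ ^ 2 : ℝ) : ℂ) * hform w w :=
  amplitude_expansion (current_planeWave_eq_zero c h.norm_eq_one h.left_eq h.right_eq h.exp_ne)
    h.left_ne h.right_ne u x

/-- A stationary state in `𝓑*` is bounded, and asymptotic to superpositions of the two plane waves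
at both ends. -/
theorem exists_limits (h : WavePair c μ ξ ζ v w) (hC : ExpClose c C) (hu : MemBStar u)
    (hs : Scatters C μ u) :
    ∃ (L L' : ℤˣ → ℂ) (B : ℝ), (∀ y l, ‖u y l‖ ≤ B) ∧ ∀ ς : ℤˣ,
      Tendsto (fun n : ℕ => amplitude ξ v u (ς * n)) atTop (𝓝 (L ς)) ∧
      Tendsto (fun n : ℕ => amplitude ζ w u (ς * n)) atTop (𝓝 (L' ς)) ∧
      ∀ l, Summable fun y : ℤ => if 0 < (ς : ℤ) * y then
        ‖u y l - (L ς * Complex.exp (Complex.I * ((y * ξ : ℝ) : ℂ)) * v l +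
          L' ς * Complex.exp (Complex.I * ((y * ζ : ℝ) : ℂ)) * w l)‖ else 0 := by
  obtain ⟨M, K, ρ₀, hM, hK, hρ₀, hρ₀1, hdec, hdec'⟩ := exists_exp_decay hC hu
  set ρ := ρ₀ ^ (1 / 2 : ℝ)
  have hρ : 0 < ρ := Real.rpow_pos_of_pos hρ₀ _
  have hρ1 : ρ < 1 := Real.rpow_lt_one hρ₀.le hρ₀1 (by norm_num)
  have hone : ∀ {ξ : ℝ} {v : Fin 2 → ℂ}, (c.symbol ξ).mulVec v = μ • v →
      ∃ (L : ℤˣ → ℂ) (D : ℝ), 0 ≤ D ∧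
        ∀ (ς : ℤˣ) (x : ℤ), 0 ≤ ς * x → ‖amplitude ξ v u x - L ς‖ ≤ D * ρ ^ x.natAbs := by
    intro ξ v hv
    set D := (‖v 0‖ + ‖v 1‖) / ‖hform v v‖
    have hD : 0 ≤ D := by positivity
    have hinc : ∀ x, ‖amplitude ξ v u (x + 1) - amplitude ξ v u x‖ ≤ D * K * ρ ^ x.natAbs := by
      intro x
      refine (norm_amplitude_succ_sub_le c h.norm_eq_one hv hs (hdec x)).trans ?_
      rw [mul_assoc D]
      exact mul_le_mul_of_nonneg_left (hdec' x) hD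
    choose L hL using exists_limit_of_increments (mul_nonneg hD hK) hρ hρ1 hinc
    exact ⟨L, D * K / (1 - ρ), div_nonneg (mul_nonneg hD hK) (by linarith), hL⟩
  obtain ⟨L, D, hD, hL⟩ := hone h.left_eq
  obtain ⟨L', D', hD', hL'⟩ := hone h.right_eq
  have htend : ∀ {a : ℤ → ℂ} {L : ℂ} {D : ℝ} {ς : ℤˣ},
      (∀ x : ℤ, 0 ≤ ς * x → ‖a x - L‖ ≤ D * ρ ^ x.natAbs) →
      Tendsto (fun n : ℕ => a (ς * n)) atTop (𝓝 L) := by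
    intro a L D ς ha
    have h1 : Tendsto (fun n : ℕ => D * ρ ^ n) atTop (𝓝 0) := by
      simpa using (tendsto_pow_atTop_nhds_zero_of_lt_one hρ.le hρ1).const_mul D
    refine tendsto_iff_norm_sub_tendsto_zero.2 (squeeze_zero (fun _ => norm_nonneg _) ?_ h1)
    intro n
    have h2 := ha (ς * n) (by rw [← mul_assoc, Int.units_coe_mul_self, one_mul]; positivity)
    rwa [Int.natAbs_mul, Int.units_natAbs, one_mul, Int.natAbs_natCast] at h2
  have hbound : ∀ {a : ℤ → ℂ} {L : ℤˣ → ℂ} {D : ℝ}, 0 ≤ D →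
      (∀ (ς : ℤˣ) (x : ℤ), 0 ≤ ς * x → ‖a x - L ς‖ ≤ D * ρ ^ x.natAbs) →
      ∀ x, ‖a x‖ ≤ D + (‖L 1‖ + ‖L (-1)‖) := by
    intro a L D hD ha x
    have h2 : ∀ ς : ℤˣ, 0 ≤ ς * x → ‖a x‖ ≤ D + ‖L ς‖ := by
      intro ς hς
      have h3 := ha ς x hς
      have h4 : ρ ^ x.natAbs ≤ 1 := pow_le_one₀ hρ.le hρ1.le
      have h5 := norm_le_norm_sub_add (a x) (L ς)
      nlinarith
    rcases le_total 0 x with hx | hx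
    · have := h2 1 (by simpa using hx)
      linarith [norm_nonneg (L (-1))]
    · have := h2 (-1) (by simpa using hx)
      linarith [norm_nonneg (L 1)]
  have hbA := hbound hD hL
  have hbB := hbound hD' hL'
  set R := D + (‖L 1‖ + ‖L (-1)‖)
  set R' := D' + (‖L' 1‖ + ‖L' (-1)‖)
  have hval : ∀ (y : ℤ) (l : Fin 2), ∃ x : ℤ, (x = y ∨ x = y + 1) ∧
      u y l = amplitude ξ v u x * planeWave ξ v y l + amplitude ζ w u x * planeWave ζ w y l := by
    intro y l
    fin_cases l
    · exact ⟨y + 1, Or.inr rfl, by simpa using (h.expansion u (y + 1)).1⟩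
    · exact ⟨y, Or.inl rfl, (h.expansion u y).2.1⟩
  have hcomb : ∀ (a b : ℂ) (y : ℤ) (l : Fin 2),
      ‖a * planeWave ξ v y l + b * planeWave ζ w y l‖ ≤
        ‖a‖ * (‖v 0‖ + ‖v 1‖) + ‖b‖ * (‖w 0‖ + ‖w 1‖) := by
    intro a b y l
    have hcoord : ∀ v : Fin 2 → ℂ, ‖v l‖ ≤ ‖v 0‖ + ‖v 1‖ := fun v => by
      fin_cases l
      · exact le_add_of_nonneg_right (norm_nonneg _)
      · exact le_add_of_nonneg_left (norm_nonneg _)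
    refine (norm_add_le _ _).trans ?_
    rw [norm_mul, norm_mul, norm_planeWave, norm_planeWave]
    gcongr <;> exact hcoord _
  refine ⟨L, L', R * (‖v 0‖ + ‖v 1‖) + R' * (‖w 0‖ + ‖w 1‖), fun y l => ?_, fun ς =>
    ⟨htend (hL ς), htend (hL' ς), fun l => ?_⟩⟩
  · obtain ⟨x, -, hx⟩ := hval y l
    rw [hx]
    refine (hcomb _ _ y l).trans ?_
    gcongr
    exacts [hbA x, hbB x]
  · have hgeom : Summable fun y : ℤ => ρ ^ y.natAbs :=
      Summable.of_nat_of_neg (by simpa using summable_geometric_of_lt_one hρ.le hρ1)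
        (by simpa using summable_geometric_of_lt_one hρ.le hρ1)
    refine Summable.of_nonneg_of_le (fun y => by split_ifs <;> positivity) (fun y => ?_)
      (hgeom.mul_left ((D * (‖v 0‖ + ‖v 1‖) + D' * (‖w 0‖ + ‖w 1‖)) * ρ⁻¹))
    split_ifs with hy
    · obtain ⟨x, hxy, hx⟩ := hval y l
      -- passing from `y` to `y + 1` may lose one power of `ρ`
      have hx0 : 0 ≤ ς * x ∧ y.natAbs ≤ x.natAbs + 1 := by
        rcases Int.units_eq_one_or ς with rfl | rfl <;>
          simp only [Units.val_neg, Units.val_one, neg_mul, one_mul] at hy ⊢ <;> omega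
      have hpow : ρ ^ x.natAbs ≤ ρ⁻¹ * ρ ^ y.natAbs := by
        rw [← div_eq_inv_mul, le_div_iff₀ hρ, ← pow_succ]
        exact pow_le_pow_of_le_one hρ.le hρ1.le hx0.2
      have e : u y l - (L ς * Complex.exp (Complex.I * ((y * ξ : ℝ) : ℂ)) * v l +
          L' ς * Complex.exp (Complex.I * ((y * ζ : ℝ) : ℂ)) * w l) =
          (amplitude ξ v u x - L ς) * planeWave ξ v y l +
            (amplitude ζ w u x - L' ς) * planeWave ζ w y l := by
        rw [hx]; simp only [planeWave]; ring
      rw [e]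
      refine (hcomb _ _ y l).trans ?_
      calc _ ≤ (D * (ρ⁻¹ * ρ ^ y.natAbs)) * (‖v 0‖ + ‖v 1‖) +
            (D' * (ρ⁻¹ * ρ ^ y.natAbs)) * (‖w 0‖ + ‖w 1‖) := by
            gcongr
            · exact (hL ς x hx0.1).trans (by gcongr)
            · exact (hL' ς x hx0.1).trans (by gcongr)
        _ = _ := by ring
    · positivity

/-- Unique continuation from infinity. -/
theorem eq_zero_of_tendsto_zero (h : WavePair c μ ξ ζ v w)
    (hCu : ∀ x, C x ∈ Matrix.unitaryGroup (Fin 2) ℂ) (ha : ∀ x, C x 0 0 ≠ 0)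
    (hC : ExpClose c C) (hu : MemBStar u) (hs : Scatters C μ u) (ς : ℤˣ)
    (h0 : Tendsto (fun n : ℕ => amplitude ξ v u (ς * n)) atTop (𝓝 0))
    (h0' : Tendsto (fun n : ℕ => amplitude ζ w u (ς * n)) atTop (𝓝 0)) : u = 0 := by
  obtain ⟨M, K, ρ, hM, -, hρ, hρ1, hdec, -⟩ := exists_exp_decay hC hu
  set a : ℤ → ℂ × ℂ := fun x => (amplitude ξ v u x, amplitude ζ w u x)
  set P := ‖v 0‖ + ‖v 1‖
  set Q := ‖w 0‖ + ‖w 1‖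
  set T := P / ‖hform v v‖ + Q / ‖hform w w‖
  have hfst : ∀ x, ‖amplitude ξ v u x‖ ≤ ‖a x‖ := fun x => norm_fst_le (a x)
  have hsnd : ∀ x, ‖amplitude ζ w u x‖ ≤ ‖a x‖ := fun x => norm_snd_le (a x)
  have hux : ∀ x, ‖u x 0‖ + ‖u x 1‖ ≤ (P + Q) * (‖a x‖ + ‖a (x + 1)‖) := by
    intro x
    have e0 := (h.expansion u (x + 1)).1
    have e1 := (h.expansion u x).2.1
    rw [add_sub_cancel_right] at e0
    have h1 : ∀ (z : ℤ) (l : Fin 2), ‖amplitude ξ v u z * planeWave ξ v x l +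
        amplitude ζ w u z * planeWave ζ w x l‖ ≤ (‖v l‖ + ‖w l‖) * ‖a z‖ := by
      intro z l
      refine (norm_add_le _ _).trans ?_
      rw [norm_mul, norm_mul, norm_planeWave, norm_planeWave, add_mul, mul_comm (‖v l‖),
        mul_comm (‖w l‖)]
      gcongr
      exacts [hfst z, hsnd z]
    have h2 := h1 (x + 1) 0
    have h3 := h1 x 1
    rw [← e0] at h2
    rw [← e1] at h3
    have p1 := mul_nonneg (add_nonneg (norm_nonneg (v 0)) (norm_nonneg (w 0))) (norm_nonneg (a x))
    have p2 := mul_nonneg (add_nonneg (norm_nonneg (v 1)) (norm_nonneg (w 1)))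
      (norm_nonneg (a (x + 1)))
    simp only [P, Q]
    linarith
  have hinc : ∀ x, ‖a (x + 1) - a x‖ ≤
      T * M * (P + Q) * ρ ^ x.natAbs * (‖a x‖ + ‖a (x + 1)‖) := by
    intro x
    have h1 := norm_amplitude_succ_sub_le c h.norm_eq_one h.left_eq hs (hdec x)
    have h2 := norm_amplitude_succ_sub_le c h.norm_eq_one h.right_eq hs (hdec x)
    have h3 : M * ρ ^ x.natAbs * (‖u x 0‖ + ‖u x 1‖) ≤
        M * ρ ^ x.natAbs * ((P + Q) * (‖a x‖ + ‖a (x + 1)‖)) := by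
      gcongr
      exact hux x
    have h4 : ‖a (x + 1) - a x‖ ≤ T * (M * ρ ^ x.natAbs * (‖u x 0‖ + ‖u x 1‖)) := by
      have h5 : 0 ≤ M * ρ ^ x.natAbs * (‖u x 0‖ + ‖u x 1‖) := by positivity
      refine max_le (h1.trans ?_) (h2.trans ?_)
      · exact mul_le_mul_of_nonneg_right (le_add_of_nonneg_right (by positivity)) h5
      · exact mul_le_mul_of_nonneg_right (le_add_of_nonneg_left (by positivity)) h5
    calc _ ≤ T * (M * ρ ^ x.natAbs * ((P + Q) * (‖a x‖ + ‖a (x + 1)‖))) :=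
          h4.trans (mul_le_mul_of_nonneg_left h3 (by positivity))
      _ = _ := by ring
  obtain ⟨x, hx⟩ := exists_eq_zero_of_increments (by positivity) hρ hρ1 hinc ς
    (h0.prodMk_nhds h0')
  have hx1 : amplitude ξ v u x = 0 := congrArg Prod.fst hx
  have hx2 : amplitude ζ w u x = 0 := congrArg Prod.snd hx
  have hμ0 : μ ≠ 0 := fun h' => by simpa [h'] using h.norm_eq_one
  refine eq_zero_of_eq_zero_at_bond hCu ha hμ0 hs (x₀ := x) ?_ ?_
  · rw [(h.expansion u x).1, hx1, hx2]; simp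
  · rw [(h.expansion u x).2.1, hx1, hx2]; simp

/-- If one plane wave is absent at one end and the other wave at the other end, and their currents
have opposite signs, then conservation of the current forces both remaining amplitudes to
vanish. -/
theorem limit_eq_zero_of_current (h : WavePair c μ ξ ζ v w)
    (hCu : ∀ x, C x ∈ Matrix.unitaryGroup (Fin 2) ℂ) (hs : Scatters C μ u) {j j' : ℝ}
    (hj : hform v v = j) (hj' : hform w w = j') (hjj : j * j' < 0) {ς : ℤˣ} {L L' : ℤˣ → ℂ}
    (hL : ∀ ς : ℤˣ, Tendsto (fun n : ℕ => amplitude ξ v u (ς * n)) atTop (𝓝 (L ς)))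
    (hL' : ∀ ς : ℤˣ, Tendsto (fun n : ℕ => amplitude ζ w u (ς * n)) atTop (𝓝 (L' ς)))
    (h0 : L ς = 0) (h0' : L' (-ς) = 0) : L' ς = 0 := by
  have hlim : ∀ σ : ℤˣ, current u u 0 =
      ((‖L σ‖ ^ 2 : ℝ) : ℂ) * j + ((‖L' σ‖ ^ 2 : ℝ) : ℂ) * j' := by
    intro σ
    have hco : Continuous fun t : ℝ => (t : ℂ) := Complex.continuous_ofReal
    have h1 := (((hco.tendsto _).comp ((hL σ).norm.pow 2)).mul_const (j : ℂ)).add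
      (((hco.tendsto _).comp ((hL' σ).norm.pow 2)).mul_const (j' : ℂ))
    refine tendsto_nhds_unique (tendsto_const_nhds.congr fun n : ℕ => ?_) h1
    rw [current_eq_of_scatters hCu h.norm_eq_one hs hs 0 (σ * n), (h.expansion u (σ * n)).2.2,
      hj, hj']
    rfl
  have h1 := (hlim ς).symm.trans (hlim (-ς))
  rw [h0, h0'] at h1
  have h2 : ‖L' ς‖ ^ 2 * j' = ‖L (-ς)‖ ^ 2 * j := by
    have : (((‖L' ς‖ ^ 2 * j' : ℝ)) : ℂ) = ((‖L (-ς)‖ ^ 2 * j : ℝ) : ℂ) := by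
      simpa using h1
    exact_mod_cast this
  have h3 : ‖L' ς‖ ^ 2 * j' ^ 2 = ‖L (-ς)‖ ^ 2 * (j * j') := by
    rw [pow_two j', ← mul_assoc, h2]; ring
  have h4 : ‖L (-ς)‖ ^ 2 * (j * j') ≤ 0 := mul_nonpos_of_nonneg_of_nonpos (sq_nonneg _) hjj.le
  have h5 : 0 < j' ^ 2 := by
    have : j' ≠ 0 := fun h => by simp [h] at hjj
    positivity
  have h6 : ‖L' ς‖ ^ 2 = 0 := by nlinarith [sq_nonneg ‖L' ς‖]
  simpa using h6

end WavePair

/-! ### The symbol and its eigenvectors -/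

theorem eigenProj_mulVec {A : Matrix (Fin 2) (Fin 2) ℂ} {μ : ℂ} {v : Fin 2 → ℂ}
    (hv : A.mulVec v = μ • v) : (eigenProj A μ).mulVec v = v := by
  set S := Module.End.eigenspace (Matrix.toEuclideanLin A) μ
  have hmem : WithLp.toLp 2 v ∈ S := by
    rw [Module.End.mem_eigenspace_iff]
    ext i
    simpa using congrFun hv i
  have hsum : WithLp.toLp 2 v = v 0 • EuclideanSpace.single (0 : Fin 2) (1 : ℂ) +
      v 1 • EuclideanSpace.single (1 : Fin 2) (1 : ℂ) := by
    ext i; fin_cases i <;> simp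
  have hproj : S.starProjection (WithLp.toLp 2 v) = WithLp.toLp 2 v :=
    Submodule.starProjection_eq_self_iff.2 hmem
  ext k
  have h1 := congrArg (fun z : EuclideanSpace ℂ (Fin 2) => z k) hproj
  rw [hsum, map_add, map_smul, map_smul, ← hsum] at h1
  simp only [PiLp.add_apply, PiLp.smul_apply, smul_eq_mul] at h1
  simp only [Matrix.mulVec, dotProduct, Fin.sum_univ_two, eigenProj, Matrix.of_apply]
  rw [← h1]
  ring

theorem LimitCoin.symbol_eq (c : LimitCoin) (ξ : ℝ) :
    c.symbol ξ = Complex.exp (Complex.I * ((c.γ / 2 : ℝ) : ℂ)) •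
      !![(c.p : ℂ) * Complex.exp (Complex.I * ((ξ + c.α - c.γ / 2 : ℝ) : ℂ)),
        (c.q : ℂ) * Complex.exp (Complex.I * ((ξ + c.β - c.γ / 2 : ℝ) : ℂ));
        -(c.q : ℂ) * conj (Complex.exp (Complex.I * ((ξ + c.β - c.γ / 2 : ℝ) : ℂ))),
        (c.p : ℂ) * conj (Complex.exp (Complex.I * ((ξ + c.α - c.γ / 2 : ℝ) : ℂ)))] := by
  have hsplit : ∀ t : ℝ, Complex.exp (Complex.I * ((ξ + t - c.γ / 2 : ℝ) : ℂ)) =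
      Complex.exp (Complex.I * (ξ : ℂ)) * Complex.exp (Complex.I * ((t - c.γ / 2 : ℝ) : ℂ)) := by
    intro t; rw [← Complex.exp_add]; congr 1; push_cast; ring
  have hneg : ∀ t : ℝ, Complex.exp (-Complex.I * (t : ℂ)) =
      conj (Complex.exp (Complex.I * (t : ℂ))) := by
    intro t; rw [← Complex.exp_conj]; simp
  rw [hsplit, hsplit, LimitCoin.symbol, LimitCoin.matrix, hneg, hneg, hneg]
  generalize Complex.exp (Complex.I * ((c.γ / 2 : ℝ) : ℂ)) = g
  generalize Complex.exp (Complex.I * ((c.α - c.γ / 2 : ℝ) : ℂ)) = a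
  generalize Complex.exp (Complex.I * ((c.β - c.γ / 2 : ℝ) : ℂ)) = b
  generalize Complex.exp (Complex.I * (ξ : ℂ)) = e
  ext i j
  fin_cases i <;> fin_cases j <;> simp [Matrix.diagonal_mul] <;> ring

theorem exp_mul_I_eq (t : ℝ) : Complex.exp (Complex.I * (t : ℂ)) =
    (Real.cos t : ℂ) + (Real.sin t : ℂ) * Complex.I := by
  rw [mul_comm, Complex.exp_mul_I, Complex.ofReal_cos, Complex.ofReal_sin]

theorem exp_quasiEnergy (γ θ : ℝ) : Complex.exp (Complex.I * (θ : ℂ)) =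
    Complex.exp (Complex.I * ((γ / 2 : ℝ) : ℂ)) *
      Complex.exp (Complex.I * ((θ - γ / 2 : ℝ) : ℂ)) := by
  rw [← Complex.exp_add]; congr 1; push_cast; ring

/-- The dispersion relation `cos (θ - γ/2) = p cos (ξ + α - γ/2)`. -/
theorem LimitCoin.mem_fermi (c : LimitCoin) {θ ξ : ℝ}
    (h : Real.cos (θ - c.γ / 2) = c.p * Real.cos (ξ + c.α - c.γ / 2)) : ξ ∈ c.fermi θ := by
  change (_ - _ : Matrix (Fin 2) (Fin 2) ℂ).det = 0
  have hβ := conj_exp_mul_self (ξ + c.β - c.γ / 2)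
  have hpq : (c.p : ℂ) ^ 2 + (c.q : ℂ) ^ 2 = 1 := by exact_mod_cast c.sq_add_sq
  have hX : (Real.sin (ξ + c.α - c.γ / 2) : ℂ) ^ 2 + (Real.cos (ξ + c.α - c.γ / 2) : ℂ) ^ 2 = 1 := by
    exact_mod_cast Real.sin_sq_add_cos_sq _
  have hΘ : (Real.sin (θ - c.γ / 2) : ℂ) ^ 2 + (Real.cos (θ - c.γ / 2) : ℂ) ^ 2 = 1 := by
    exact_mod_cast Real.sin_sq_add_cos_sq _
  have h' : (Real.cos (θ - c.γ / 2) : ℂ) = c.p * (Real.cos (ξ + c.α - c.γ / 2) : ℂ) := by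
    exact_mod_cast h
  rw [c.symbol_eq, exp_quasiEnergy c.γ θ, Matrix.det_fin_two]
  simp only [Matrix.sub_apply, Matrix.smul_apply, Matrix.of_apply, Matrix.cons_val',
    Matrix.cons_val_zero, Matrix.cons_val_one, Matrix.cons_val_fin_one, Matrix.one_apply_eq,
    smul_eq_mul, mul_one, ne_eq, zero_ne_one, one_ne_zero, not_false_eq_true, Matrix.one_apply_ne,
    mul_zero, sub_zero]
  rw [exp_mul_I_eq (ξ + c.α - c.γ / 2), exp_mul_I_eq (θ - c.γ / 2)]
  simp only [map_add, map_mul, Complex.conj_ofReal, Complex.conj_I]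
  generalize Complex.exp (Complex.I * ((c.γ / 2 : ℝ) : ℂ)) = g at *
  generalize Complex.exp (Complex.I * ((ξ + c.β - c.γ / 2 : ℝ) : ℂ)) = b at *
  generalize (Real.sin (ξ + c.α - c.γ / 2) : ℂ) = s at *
  generalize (Real.cos (ξ + c.α - c.γ / 2) : ℂ) = k at *
  generalize (Real.sin (θ - c.γ / 2) : ℂ) = S at *
  generalize (Real.cos (θ - c.γ / 2) : ℂ) = Q at *
  have hI := Complex.I_sq
  linear_combination g ^ 2 * (c.q : ℂ) ^ 2 * hβ + g ^ 2 * (c.p : ℂ) ^ 2 * hX + g ^ 2 * hpq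
    - g ^ 2 * hΘ + 2 * g ^ 2 * (Q + S * Complex.I) * h' + g ^ 2 * (S ^ 2 - (c.p : ℂ) ^ 2 * s ^ 2) * hI

theorem hform_self (v : Fin 2 → ℂ) : hform v v = ((‖v 0‖ ^ 2 - ‖v 1‖ ^ 2 : ℝ) : ℂ) := by
  simp only [hform, ← Complex.normSq_eq_conj_mul_self, Complex.normSq_eq_norm_sq]
  push_cast; ring

/-- The current of an eigenvector of the symbol is proportional to its group velocity. -/
theorem LimitCoin.current_eq (c : LimitCoin) {θ ξ : ℝ} {v : Fin 2 → ℂ}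
    (hv : (c.symbol ξ).mulVec v = Complex.exp (Complex.I * (θ : ℂ)) • v) :
    (‖v 0‖ ^ 2 - ‖v 1‖ ^ 2) * Real.sin (θ - c.γ / 2) =
      c.p * Real.sin (ξ + c.α - c.γ / 2) * (‖v 0‖ ^ 2 + ‖v 1‖ ^ 2) := by
  have h0 := congrFun hv 0
  have h1 := congrFun hv 1
  rw [c.symbol_eq, exp_quasiEnergy c.γ θ] at h0 h1
  simp only [Matrix.mulVec, dotProduct, Fin.sum_univ_two, Matrix.smul_apply, Matrix.of_apply,
    Matrix.cons_val', Matrix.cons_val_zero, Matrix.cons_val_one, Matrix.cons_val_fin_one,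
    Pi.smul_apply, smul_eq_mul] at h0 h1
  have hg : Complex.exp (Complex.I * ((c.γ / 2 : ℝ) : ℂ)) ≠ 0 := Complex.exp_ne_zero _
  have h0' := congrArg (fun z => (conj (v 0) * z).im)
    (mul_left_cancel₀ hg (show _ * _ = _ * _ by linear_combination h0) :
      (c.p : ℂ) * Complex.exp (Complex.I * ((ξ + c.α - c.γ / 2 : ℝ) : ℂ)) * v 0 +
        (c.q : ℂ) * Complex.exp (Complex.I * ((ξ + c.β - c.γ / 2 : ℝ) : ℂ)) * v 1 =
        Complex.exp (Complex.I * ((θ - c.γ / 2 : ℝ) : ℂ)) * v 0)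
  have h1' := congrArg (fun z => (conj (v 1) * z).im)
    (mul_left_cancel₀ hg (show _ * _ = _ * _ by linear_combination h1) :
      -(c.q : ℂ) * conj (Complex.exp (Complex.I * ((ξ + c.β - c.γ / 2 : ℝ) : ℂ))) * v 0 +
        (c.p : ℂ) * conj (Complex.exp (Complex.I * ((ξ + c.α - c.γ / 2 : ℝ) : ℂ))) * v 1 =
        Complex.exp (Complex.I * ((θ - c.γ / 2 : ℝ) : ℂ)) * v 1)
  simp only [← Complex.normSq_eq_norm_sq, Complex.normSq_apply]
  rw [exp_mul_I_eq, exp_mul_I_eq, exp_mul_I_eq] at h0' h1'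
  simp only [Complex.mul_im, Complex.mul_re, Complex.add_im, Complex.add_re, Complex.ofReal_re,
    Complex.ofReal_im, Complex.I_re, Complex.I_im, Complex.conj_re, Complex.conj_im,
    Complex.neg_re, Complex.neg_im] at h0' h1'
  linear_combination h1' - h0'

theorem LimitCoin.exists_eigenvector (c : LimitCoin) {θ ξ : ℝ} (h : ξ ∈ c.fermi θ) :
    ∃ v : Fin 2 → ℂ, v ≠ 0 ∧ (c.symbol ξ).mulVec v = Complex.exp (Complex.I * (θ : ℂ)) • v := by
  obtain ⟨v, hv0, hv⟩ := Matrix.exists_mulVec_eq_zero_iff.2 h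
  refine ⟨v, hv0, ?_⟩
  rw [Matrix.sub_mulVec, Matrix.smul_mulVec, Matrix.one_mulVec, sub_eq_zero] at hv
  exact hv

theorem LimitCoin.hasDerivAt_phase (c : LimitCoin) {ξ : ℝ}
    (h : |c.p * Real.cos (ξ + c.α - c.γ / 2)| < 1) :
    HasDerivAt c.phase (c.p * Real.sin (ξ + c.α - c.γ / 2) /
      Real.sqrt (1 - (c.p * Real.cos (ξ + c.α - c.γ / 2)) ^ 2)) ξ := by
  rw [abs_lt] at h
  have h1 : HasDerivAt (fun ξ => c.p * Real.cos (ξ + c.α - c.γ / 2))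
      (c.p * (-Real.sin (ξ + c.α - c.γ / 2) * 1)) ξ :=
    (((hasDerivAt_id ξ).add_const c.α).sub_const (c.γ / 2)).cos.const_mul c.p
  have h2 := ((Real.hasDerivAt_arccos h.1.ne' h.2.ne).comp ξ h1).const_add (c.γ / 2)
  refine h2.congr_deriv ?_
  ring

/-! ### Inside the bands -/

/-- Inside the bands, one of the two branches of eigenvalues passes through `e^{iθ}` at all points
of `M(θ)`, and the radiation condition excludes one direction for the component of `u` in that
branch. -/
theorem LimitCoin.exists_branch (c : LimitCoin) {θ : ℝ} (hθ : θ ∈ c.J \ c.thresholds) {κ : ℤˣ}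
    {φ : ℝ → ℝ} {u : LatticeFun} (hrad : Radiation c φ θ κ u) :
    |Real.cos (θ - c.γ / 2)| < c.p ∧ ∃ (A : ℝ → Matrix (Fin 2) (Fin 2) ℂ) (σ : ℤˣ),
      (∀ ξ ∈ c.fermi θ, NotMemWF φ A u ξ σ) ∧
      ∀ ξ, Real.cos (θ - c.γ / 2) = c.p * Real.cos (ξ + c.α - c.γ / 2) → ∀ v : Fin 2 → ℂ,
        (c.symbol ξ).mulVec v = Complex.exp (Complex.I * (θ : ℂ)) • v →
        (A ξ).mulVec v = v := by
  obtain ⟨hJ, hT⟩ := hθ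
  simp only [LimitCoin.thresholds, Set.mem_insert_iff, Set.mem_singleton_iff, not_or] at hT
  obtain ⟨t1, t2, t3, t4⟩ := hT
  have hp0 := Real.arccos_nonneg c.p
  have hcosp : Real.cos (Real.arccos c.p) = c.p :=
    Real.cos_arccos (by linarith [c.p_pos]) c.p_le_one
  have hcos : ∀ t, Real.arccos c.p < t → t < Real.pi - Real.arccos c.p → |Real.cos t| < c.p := by
    intro t h1 h2
    rw [abs_lt]
    constructor
    · have h3 := Real.cos_lt_cos_of_nonneg_of_le_pi (by linarith : 0 ≤ t) (by linarith) h2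
      rwa [Real.cos_pi_sub, hcosp] at h3
    · have h3 := Real.cos_lt_cos_of_nonneg_of_le_pi hp0 (by linarith : t ≤ Real.pi) h1
      rwa [hcosp] at h3
  have hunit : ∀ κ : ℤˣ, κ ≠ -κ := fun κ => by
    rcases Int.units_eq_one_or κ with rfl | rfl <;> decide
  rcases hJ with ⟨h1, h2⟩ | ⟨h1, h2⟩
  · have h3 : Real.arccos c.p < θ - c.γ / 2 := by
      have := lt_of_le_of_ne h1 (Ne.symm t1); linarith
    have h4 : θ - c.γ / 2 < Real.pi - Real.arccos c.p := by
      have := lt_of_le_of_ne h2 t2; linarith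
    refine ⟨hcos _ h3 h4, c.proj₁, κ, fun ξ hξ => ?_, fun ξ hξ v hv => ?_⟩
    · by_contra h
      exact hunit κ ((hrad ξ hξ κ).1 h)
    · have e : c.eigval₁ ξ = Complex.exp (Complex.I * (θ : ℂ)) := by
        rw [LimitCoin.eigval₁, LimitCoin.phase, ← hξ,
          Real.arccos_cos (by linarith) (by linarith)]
        congr 3; ring
      rw [LimitCoin.proj₁, e]
      exact eigenProj_mulVec hv
  · have h3 : Real.arccos c.p < 2 * Real.pi - (θ - c.γ / 2) := by
      have := lt_of_le_of_ne h2 t4; linarith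
    have h4 : 2 * Real.pi - (θ - c.γ / 2) < Real.pi - Real.arccos c.p := by
      have := lt_of_le_of_ne h1 (Ne.symm t3); linarith
    have hcos2 := Real.cos_two_pi_sub (θ - c.γ / 2)
    refine ⟨hcos2 ▸ hcos _ h3 h4, c.proj₂, -κ, fun ξ hξ => ?_, fun ξ hξ v hv => ?_⟩
    · by_contra h
      exact hunit κ ((hrad ξ hξ (-κ)).2 h).symm
    · have e : c.eigval₂ ξ = Complex.exp (Complex.I * (θ : ℂ)) := by
        rw [LimitCoin.eigval₂, LimitCoin.phase, ← hξ, ← hcos2,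
          Real.arccos_cos (by linarith) (by linarith), Complex.exp_eq_exp_iff_exists_int]
        refine ⟨-1, ?_⟩
        push_cast; ring
      rw [LimitCoin.proj₂, e]
      exact eigenProj_mulVec hv

/-- Inside the bands `M(θ)` consists of two points modulo the period, and the velocities at these
points have opposite signs. -/
theorem LimitCoin.exists_wavePair (c : LimitCoin) {θ : ℝ}
    (hθ : |Real.cos (θ - c.γ / 2)| < c.p) :
    ∃ (ξ ζ : ℝ) (v w : Fin 2 → ℂ) (j j' : ℝ),
      WavePair c (Complex.exp (Complex.I * (θ : ℂ))) ξ ζ v w ∧ v ≠ 0 ∧ w ≠ 0 ∧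
      hform v v = j ∧ hform w w = j' ∧ j * j' < 0 ∧
      Real.cos (θ - c.γ / 2) = c.p * Real.cos (ξ + c.α - c.γ / 2) ∧
      Real.cos (θ - c.γ / 2) = c.p * Real.cos (ζ + c.α - c.γ / 2) ∧
      0 < deriv c.phase ξ ∧ deriv c.phase ζ < 0 := by
  have hp := c.p_pos
  have hθ' := abs_lt.1 hθ
  set Θ := θ - c.γ / 2
  set X := Real.arccos (Real.cos Θ / c.p)
  have hb : -1 < Real.cos Θ / c.p ∧ Real.cos Θ / c.p < 1 := by
    rw [lt_div_iff₀ hp, div_lt_one hp]; constructor <;> linarith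
  have hX0 : 0 < X := Real.arccos_pos.2 hb.2
  have hXpi : X < Real.pi := by
    refine lt_of_le_of_ne (Real.arccos_le_pi _) fun h => ?_
    exact absurd (Real.arccos_eq_pi.1 h) (not_le.2 hb.1)
  have hcosX : Real.cos Θ = c.p * Real.cos X := by
    rw [Real.cos_arccos hb.1.le hb.2.le]; field_simp
  have hsinX : 0 < Real.sin X := Real.sin_pos_of_pos_of_lt_pi hX0 hXpi
  set ξ := X - c.α + c.γ / 2
  set ζ := -X - c.α + c.γ / 2
  have hξX : ξ + c.α - c.γ / 2 = X := by simp only [ξ]; ring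
  have hζX : ζ + c.α - c.γ / 2 = -X := by simp only [ζ]; ring
  have hcosξ : Real.cos Θ = c.p * Real.cos (ξ + c.α - c.γ / 2) := by rw [hξX, hcosX]
  have hcosζ : Real.cos Θ = c.p * Real.cos (ζ + c.α - c.γ / 2) := by
    rw [hζX, Real.cos_neg, hcosX]
  have hcos1 : |Real.cos Θ| < 1 := hθ.trans_le c.p_le_one
  have hsqrt : 0 < Real.sqrt (1 - Real.cos Θ ^ 2) :=
    Real.sqrt_pos.2 (by rw [sub_pos, sq_lt_one_iff_abs_lt_one]; exact hcos1)
  obtain ⟨v, hv0, hv⟩ := c.exists_eigenvector (c.mem_fermi hcosξ)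
  obtain ⟨w, hw0, hw⟩ := c.exists_eigenvector (c.mem_fermi hcosζ)
  have hpos : ∀ {v : Fin 2 → ℂ}, v ≠ 0 → 0 < ‖v 0‖ ^ 2 + ‖v 1‖ ^ 2 := by
    intro v hv
    obtain ⟨k, hk⟩ := Function.ne_iff.1 hv
    have := (sq_pos_of_pos (norm_pos_iff.2 hk)).trans_le (norm_sq_le_normSq2 v k)
    exact this
  have hj := c.current_eq hv
  have hj' := c.current_eq hw
  rw [hξX] at hj
  rw [hζX, Real.sin_neg] at hj'
  set j := ‖v 0‖ ^ 2 - ‖v 1‖ ^ 2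
  set j' := ‖w 0‖ ^ 2 - ‖w 1‖ ^ 2
  have hj1 : 0 < j * Real.sin Θ := by
    rw [hj]; exact mul_pos (mul_pos hp hsinX) (hpos hv0)
  have hj2 : j' * Real.sin Θ < 0 := by
    rw [hj']
    exact mul_neg_of_neg_of_pos (mul_neg_of_pos_of_neg hp (by linarith)) (hpos hw0)
  have hjj : j * j' < 0 := by
    have h1 : (j * j') * Real.sin Θ ^ 2 < 0 := by
      have := mul_neg_of_pos_of_neg hj1 hj2
      nlinarith
    by_contra h2
    have := mul_nonneg (not_lt.1 h2) (sq_nonneg (Real.sin Θ))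
    linarith
  refine ⟨ξ, ζ, v, w, j, j', ⟨?_, hv, hw, ?_, ?_, ?_⟩, hv0, hw0, hform_self v, hform_self w, hjj,
    hcosξ, hcosζ, ?_, ?_⟩
  · rw [mul_comm, Complex.norm_exp_ofReal_mul_I]
  · intro h
    rw [Complex.exp_eq_exp_iff_exists_int] at h
    obtain ⟨n, hn⟩ := h
    have h1 : ζ = ξ + n * (2 * Real.pi) := by
      have h2 : Complex.I * (ζ : ℂ) = Complex.I * ((ξ + n * (2 * Real.pi) : ℝ) : ℂ) := by
        rw [hn]; push_cast; ring
      exact_mod_cast mul_left_cancel₀ Complex.I_ne_zero h2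
    have h3 : X = (-n : ℝ) * Real.pi := by simp only [ξ, ζ] at h1; linarith
    have h4 : (0 : ℝ) < -n := by
      by_contra h5
      have := mul_nonpos_of_nonpos_of_nonneg (not_lt.1 h5) Real.pi_pos.le
      linarith
    have h5 : (-n : ℝ) < 1 := by
      by_contra h6
      have := mul_le_mul_of_nonneg_right (not_lt.1 h6) Real.pi_pos.le
      linarith
    have h6 : (0 : ℤ) < -n := by exact_mod_cast h4
    have h7 : (-n : ℤ) < 1 := by exact_mod_cast h5
    omega
  · rw [hform_self]
    exact_mod_cast left_ne_zero_of_mul hjj.ne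
  · rw [hform_self]
    exact_mod_cast right_ne_zero_of_mul hjj.ne
  · rw [(c.hasDerivAt_phase (by rw [← hcosξ]; exact hcos1)).deriv, ← hcosξ, hξX]
    positivity
  · rw [(c.hasDerivAt_phase (by rw [← hcosζ]; exact hcos1)).deriv, ← hcosζ, hζX, Real.sin_neg]
    exact div_neg_of_neg_of_pos (mul_neg_of_pos_of_neg hp (by linarith)) hsqrt

theorem summable_halfLine_iff {f : ℤ → ℝ} (σ τ : ℤˣ) :
    (Summable fun y : ℤ => if 0 < ((-σ * τ : ℤˣ) : ℤ) * y then f y else 0) ↔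
      Summable fun y : ℤ => if ((σ : ℤ) : ℝ) * ((τ : ℤ) : ℝ) * y < 0 then f y else 0 := by
  have h : ∀ y : ℤ, (0 < ((-σ * τ : ℤˣ) : ℤ) * y) ↔ ((σ : ℤ) : ℝ) * ((τ : ℤ) : ℝ) * y < 0 := by
    intro y
    have e : ((σ : ℤ) : ℝ) * ((τ : ℤ) : ℝ) * y = (((σ : ℤ) * τ * y : ℤ) : ℝ) := by push_cast; ring
    rw [e, Int.cast_lt_zero]
    simp
  simp only [h]

end QWalk

theorem theorem4p2 (c : QWalk.LimitCoin) (C : ℤ → Matrix (Fin 2) (Fin 2) ℂ)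
    (hC : ∀ x, C x ∈ Matrix.unitaryGroup (Fin 2) ℂ)
    (hA1 : QWalk.ExpClose c C) (hA2 : QWalk.UpperLeftBounded C)
    (θ : ℝ) (hθ : θ ∈ c.J \ c.thresholds) (κ : ℤˣ)
    (u : QWalk.LatticeFun) (hu : QWalk.MemBStar u)
    (heq : ∀ x, QWalk.evolution C u x = Complex.exp (Complex.I * (θ : ℂ)) • u x)
    (hrad : QWalk.Radiation c c.phase θ κ u ∨ QWalk.Radiation c id θ κ u) :
    u = 0 := by
  have hs := QWalk.scatters_of_evolution_eq heq
  have ha : ∀ x, C x 0 0 ≠ 0 := by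
    obtain ⟨δ, hδ, h⟩ := hA2
    exact fun x => norm_pos_iff.1 (hδ.trans_le (h x))
  have hband : |Real.cos (θ - c.γ / 2)| < c.p := by
    rcases hrad with h | h <;> exact (c.exists_branch hθ h).1
  obtain ⟨ξ, ζ, v, w, j, j', hW, hv0, hw0, hj, hj', hjj, hξ, hζ, hdξ, hdζ⟩ :=
    c.exists_wavePair hband
  obtain ⟨L, L', B, hB, hL⟩ := hW.exists_limits hA1 hu hs
  -- a direction excluded over `ξ` or `ζ` removes the corresponding wave at one end
  have hleft : ∀ {φ : ℝ → ℝ} {A : ℝ → Matrix (Fin 2) (Fin 2) ℂ} {σ τ : ℤˣ},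
      QWalk.NotMemWF φ A u ξ σ → (A ξ).mulVec v = v → 0 < ((τ : ℤ) : ℝ) * deriv φ ξ →
      L (-σ * τ) = 0 := by
    intro φ A σ τ hWF hA hτ
    refine QWalk.amplitude_eq_zero_of_notMemWF hWF hA hv0 hW.exp_ne hB (τ := ((τ : ℤ) : ℝ)) ?_ hτ
      (L' := L' (-σ * τ)) (v' := w) fun l => ?_
    · rcases Int.units_eq_one_or τ with rfl | rfl <;> simp
    · exact (QWalk.summable_halfLine_iff σ τ).1 ((hL _).2.2 l)
  have hright : ∀ {φ : ℝ → ℝ} {A : ℝ → Matrix (Fin 2) (Fin 2) ℂ} {σ τ : ℤˣ},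
      QWalk.NotMemWF φ A u ζ σ → (A ζ).mulVec w = w → 0 < ((τ : ℤ) : ℝ) * deriv φ ζ →
      L' (-σ * τ) = 0 := by
    intro φ A σ τ hWF hA hτ
    refine QWalk.amplitude_eq_zero_of_notMemWF hWF hA hw0 hW.exp_ne.symm hB (τ := ((τ : ℤ) : ℝ)) ?_
      hτ (L' := L (-σ * τ)) (v' := v) fun l => ?_
    · rcases Int.units_eq_one_or τ with rfl | rfl <;> simp
    · have := (QWalk.summable_halfLine_iff σ τ).1 ((hL (-σ * τ)).2.2 l)
      refine this.congr fun y => ?_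
      rw [add_comm]
  have hzero : ∀ ς : ℤˣ, L ς = 0 → L' ς = 0 → u = 0 := fun ς h h' =>
    hW.eq_zero_of_tendsto_zero hC ha hA1 hu hs ς (h ▸ (hL ς).1) (h' ▸ (hL ς).2.1)
  rcases hrad with hrad | hrad
  · -- measured in the quasi-energy, the two waves are removed at opposite ends
    obtain ⟨-, A, σ, hWF, hA⟩ := c.exists_branch hθ hrad
    have h1 := hleft (τ := 1) (hWF ξ (c.mem_fermi hξ)) (hA ξ hξ v hW.left_eq) (by simpa using hdξ)
    have h2 := hright (τ := -1) (hWF ζ (c.mem_fermi hζ)) (hA ζ hζ w hW.right_eq)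
      (by simpa using hdζ)
    rw [mul_one] at h1
    rw [mul_neg_one] at h2
    exact hzero (-σ) h1 (hW.limit_eq_zero_of_current hC hs hj hj' hjj (fun ς => (hL ς).1)
      (fun ς => (hL ς).2.1) h1 h2)
  · -- measured in the wave number, both waves are removed at the same end
    obtain ⟨-, A, σ, hWF, hA⟩ := c.exists_branch hθ hrad
    have h1 := hleft (τ := 1) (hWF ξ (c.mem_fermi hξ)) (hA ξ hξ v hW.left_eq) (by simp)
    have h2 := hright (τ := 1) (hWF ζ (c.mem_fermi hζ)) (hA ζ hζ w hW.right_eq) (by simp)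
    exact hzero _ h1 h2
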